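/- Let $\Sigma$ be a smooth two-dimensional manifold, let $F:\Sigma\to S^3\subset\mathbb{R}^4$ be a smooth immersion, and let $\nu$ be a smooth unit normal vector field along $F$ (so $\nu(x)$ is normal to the surface and tangential to $S^3$). Let $g(u,v)=\langle dF(u),dF(v)\rangle$ be the induced metric and $h(u,v)=\langle d\nu(u),dF(v)\rangle$ the second fundamental form, and let $\lambda_1\ge\lambda_2$ be the principal curvatures (the eigenvalues of $h$ with respect to $g$), viewed as functions on $\Sigma$. Let $\psi$ be a real function, and suppose that $\lambda_1+\lambda_2=\psi(\lambda_1-\lambda_2)$ on $\Sigma$. Let $x\in\Sigma$ be a point that is not umbilic, i.e. $\lambda_1(x)>\lambda_2(x)$. Suppose that $\psi$ is of class $C^2$ near $\lambda_1(x)-\lambda_2(x)$ and that $\beta_1=1-\psi'(\lambda_1-\lambda_2)$ and $\beta_2=1+\psi'(\lambda_1-\lambda_2)$ do not vanish at $x$. Let $e_1,e_2$ be any $g$-orthonormal basis of $T_x\Sigma$ with $h(e_i,\cdot)=\lambda_i\,g(e_i,\cdot)$. Write $D_if=df(e_i)$, and $D^2_{i,i}f=(\nabla^2f)(e_i,e_i)$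 for the Hessian of $f$ with respect to the Levi-Civita connection of $g$. Then $\lambda_1$ and $\lambda_2$ are smooth near $x$, and at $x$ \begin{align*} &\sum_{i=1}^2 \beta_i \, D_{i,i}^2 \lambda_1 + \sum_{i=1}^2 \beta_i \, (\lambda_i^2-1) \, \lambda_1 - \sum_{i=1}^2 \beta_i \, \lambda_i \, (\lambda_1^2-1) \\ &= 2 \, \frac{\beta_2}{\lambda_1-\lambda_2} \, \big((D_1 \lambda_2)^2 + (D_2 \lambda_1)^2\big) + \psi''(\lambda_1-\lambda_2) \, \frac{(\beta_1+\beta_2)^2}{\beta_1^2} \, (D_1 \lambda_2)^2 \end{align*} and \begin{align*} &\sum_{i=1}^2 \beta_i \, D_{i,i}^2 \lambda_2 + \sum_{i=1}^2 \beta_i \, (\lambda_i^2-1) \, \lambda_2 - \sum_{i=1}^2 \beta_i \, \lambda_i \, (\lambda_2^2-1) \\ &= -2 \, \frac{\beta_1}{\lambda_1-\lambda_2} \, \big((D_1 \lambda_2)^2 + (D_2 \lambda_1)^2\big) + \psi''(\lambda_1-\lambda_2) \, \frac{(\beta_1+\beta_2)^2}{\beta_2^2} \, (D_2 \lambda_1)^2.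 \end{align*} -/

import Mathlib

open scoped Manifold ContDiff RealInnerProductSpace

noncomputable section

namespace WeingartenS3

/-- Euclidean space `ℝ⁴`. -/
abbrev E4 : Type := EuclideanSpace ℝ (Fin 4)

/-- The coordinate plane `ℝ²` on which surfaces are modelled. -/
abbrev E2 : Type := EuclideanSpace ℝ (Fin 2)

/-- The unit sphere `S³` in `ℝ⁴`. -/
abbrev S3 : Type := Metric.sphere (0 : EuclideanSpace ℝ (Fin (3 + 1))) 1

section Surface

variable {M : Type*} [TopologicalSpace M] [ChartedSpace E2 M]

/-- The map `F : M → S³`, regarded as a map into `ℝ⁴`. -/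
def toE4 (F : M → S3) (x : M) : E4 := (F x : E4)

/-- `F : M → S³` is a smooth immersion: it is smooth with injective differential. -/
structure IsSmoothImmersion (F : M → S3) : Prop where
  smooth : ContMDiff (𝓡 2) (𝓡 3) ∞ F
  injective : ∀ x : M, Function.Injective (mfderiv (𝓡 2) (𝓡 3) F x)

/-- `ν` is a smooth unit normal field along `F`: at each point it has length one, is orthogonal to
the surface, and is tangential to `S³`. -/
structure IsUnitNormal (F : M → S3) (ν : M → E4) : Prop where
  smooth : ContMDiff (𝓡 2) 𝓘(ℝ, E4) ∞ ν
  norm_eq_one : ∀ x : M, ‖ν x‖ = 1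
  tangent_sphere : ∀ x : M, ⟪ν x, toE4 F x⟫ = 0
  normal_surface : ∀ (x : M) (v : TangentSpace (𝓡 2) x), ⟪ν x, mvfderiv (𝓡 2) (toE4 F) x v⟫ = 0

/-- The first fundamental form (induced metric) `g(u, v) = ⟨dF(u), dF(v)⟩` at `x`. -/
def firstForm (F : M → S3) (x : M) (u v : TangentSpace (𝓡 2) x) : ℝ :=
  ⟪mvfderiv (𝓡 2) (toE4 F) x u, mvfderiv (𝓡 2) (toE4 F) x v⟫

/-- The second fundamental form `h(u, v) = ⟨dν(u), dF(v)⟩` at `x`, with the sign convention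
`∂ᵢν = hᵢᵏ ∂ₖF`. -/
def secondForm (F : M → S3) (ν : M → E4) (x : M) (u v : TangentSpace (𝓡 2) x) : ℝ :=
  ⟪mvfderiv (𝓡 2) ν x u, mvfderiv (𝓡 2) (toE4 F) x v⟫

/-- The principal curvatures at `x`: the eigenvalues of the second fundamental form with respect to
the first one. -/
def principalCurvatures (F : M → S3) (ν : M → E4) (x : M) : Set ℝ :=
  {κ | ∃ v : TangentSpace (𝓡 2) x, v ≠ 0 ∧
    ∀ w : TangentSpace (𝓡 2) x, secondForm F ν x v w = κ * firstForm F x v w}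

/-- The principal curvatures as functions on the surface: `lam F ν 0` is the larger one `λ₁` and
`lam F ν 1` is the smaller one `λ₂`. -/
def lam (F : M → S3) (ν : M → E4) : Fin 2 → M → ℝ :=
  ![fun x => sSup (principalCurvatures F ν x), fun x => sInf (principalCurvatures F ν x)]

/-- `e 0, e 1` is a basis of the tangent space at `x`, orthonormal for the induced metric and
consisting of principal directions: `h(eᵢ, ·) = λᵢ g(eᵢ, ·)`. -/
structure IsPrincipalFrame (F : M → S3) (ν : M → E4) (x : M)
    (e : Fin 2 → TangentSpace (𝓡 2) x) : Prop where
  orthonormal : ∀ i j, firstForm F x (e i) (e j) = if i = j then 1 else 0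
  principal : ∀ (i : Fin 2) (w : TangentSpace (𝓡 2) x),
    secondForm F ν x (e i) w = lam F ν i x * firstForm F x (e i) w

/-- The partial derivative `∂ᵢ φ` of a function on the coordinate plane. -/
def pd {V : Type*} [NormedAddCommGroup V] [NormedSpace ℝ V] (i : Fin 2) (φ : E2 → V) (p : E2) : V :=
  fderiv ℝ φ p (EuclideanSpace.single i 1)

/-- A function on the surface read in the preferred chart around `x`. -/
def inChart {V : Type*} (x : M) (f : M → V) (p : E2) : V :=
  f ((extChartAt (𝓡 2) x).symm p)

/-- The components `gᵢⱼ = ⟨∂ᵢF, ∂ⱼF⟩` of the induced metric in the preferred chart around `x`. -/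
def metricMatrix (F : M → S3) (x : M) (p : E2) : Matrix (Fin 2) (Fin 2) ℝ :=
  Matrix.of fun i j => ⟪pd i (inChart x (toE4 F)) p, pd j (inChart x (toE4 F)) p⟫

/-- The Christoffel symbols `Γᵏᵢⱼ = ½ ∑ₗ gᵏˡ (∂ᵢ gⱼₗ + ∂ⱼ gᵢₗ - ∂ₗ gᵢⱼ)` of the induced metric in the
preferred chart around `x`. -/
def christoffel (F : M → S3) (x : M) (k i j : Fin 2) (p : E2) : ℝ :=
  (1 / 2) * ∑ l : Fin 2, (metricMatrix F x p)⁻¹ k l *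
    (pd i (fun q => metricMatrix F x q j l) p + pd j (fun q => metricMatrix F x q i l) p
      - pd l (fun q => metricMatrix F x q i j) p)

/-- The Hessian `D²f(u, v) = ∑ᵢⱼ (∂ᵢ∂ⱼ f - ∑ₖ Γᵏᵢⱼ ∂ₖ f) uⁱ vʲ` at `x` of a function `f` with respect
to the Levi-Civita connection of the induced metric, computed in the preferred chart around `x`
(the chart by which Mathlib identifies the tangent space at `x` with `ℝ²`). -/
def hessian (F : M → S3) (f : M → ℝ) (x : M) (u v : TangentSpace (𝓡 2) x) : ℝ :=
  let p : E2 := extChartAt (𝓡 2) x x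
  let u' : E2 := u
  let v' : E2 := v
  ∑ i : Fin 2, ∑ j : Fin 2,
    (pd i (pd j (inChart x f)) p - ∑ k : Fin 2, christoffel F x k i j p * pd k (inChart x f) p)
      * u' i * v' j

/-- The weights `β₁ = 1 - ψ'(λ₁ - λ₂)` and `β₂ = 1 + ψ'(λ₁ - λ₂)` at `x`. -/
def weight (F : M → S3) (ν : M → E4) (ψ : ℝ → ℝ) (x : M) : Fin 2 → ℝ :=
  ![1 - deriv ψ (lam F ν 0 x - lam F ν 1 x), 1 + deriv ψ (lam F ν 0 x - lam F ν 1 x)]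

end Surface

end WeingartenS3

end

open scoped Manifold ContDiff RealInnerProductSpace

noncomputable section

namespace WeingartenS3

/-! Everything is computed in the chart at `x`, where `F` and `ν` become maps `G`, `N` from an open
set of the plane to `ℝ⁴`. The principal curvatures are the roots of the characteristic polynomial of
the shape operator. Its discriminant is positive near a non-umbilic point, so the roots `k > l` are
smooth there, and the given principal basis extends to a smooth orthonormal frame `X, Y` of
principal directions (`exists_isMovingFrame`).

Put `A = ⟨∇_X X, Y⟩` and `B = ⟨∇_Y Y, X⟩`. Applying the commutator `[X, Y] = -A X + B Y` to `N`
gives Codazzi, `Yk = A (k - l)` and `Xl = B (l - k)`. Applying it to `X G` gives Gauss, `XB + YA =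
A² + B² + 1 + kl`. The Hessian is `D²f(X, X) = XXf - A Yf`, and similarly for `Y`
(`IsMovingFrame.hessian_eq`).

Differentiating `k + l = ψ(k - l)` once gives `β₁ dk + β₂ dl = 0`; twice along `X` it gives `β₁ XXk
+ β₂ XXl = ψ'' (Xk - Xl)²`. Hence the second order part `β₁ XXk + β₂ YYk` equals `ψ'' (Xk - Xl)² +
β₂ (YYk - XXl)`. By Codazzi, `YYk - XXl` is `(k - l)(XB + YA)` plus products of first order terms,
and Gauss evaluates `XB + YA`. The curvature term `β₂ (k - l)(1 + kl)` cancels against the zeroth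
order terms of the identity, and the first order terms add up to `2 β₂ (k - l)(A² + B²)`, which is
the stated gradient term. Since `Xk = -(β₂/β₁) Xl`, the `ψ''` term acquires the factor `(β₁ +
β₂)²/β₁²`. This is `simons`. The identity for `l` is the same statement with the frame interchanged
and `ψ'` replaced by `-ψ'`. -/

open Filter Topology

/-! ### Derivatives along vector fields in the plane. -/

section DirectionalDerivative

variable {V : Type*} [NormedAddCommGroup V] [NormedSpace ℝ V]

/-- The derivative `X u` of a function `u` on the plane along a vector field `X`. -/
def dirDeriv (X : E2 → E2) (u : E2 → V) (q : E2) : V := fderiv ℝ u q (X q)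

lemma contDiffOn_dirDeriv {U : Set E2} (hU : IsOpen U) {X : E2 → E2} {u : E2 → V}
    (hX : ContDiffOn ℝ ∞ X U) (hu : ContDiffOn ℝ ∞ u U) : ContDiffOn ℝ ∞ (dirDeriv X u) U :=
  (hu.fderiv_of_isOpen hU (by simp)).clm_apply hX

lemma differentiableAt_of_contDiffOn {U : Set E2} (hU : IsOpen U) {u : E2 → V}
    (hu : ContDiffOn ℝ ∞ u U) {q : E2} (hq : q ∈ U) : DifferentiableAt ℝ u q :=
  (hu.contDiffAt (hU.mem_nhds hq)).differentiableAt (by simp)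

lemma dirDeriv_congr {U : Set E2} (hU : IsOpen U) (X : E2 → E2) {u v : E2 → V}
    (h : ∀ q ∈ U, u q = v q) {q : E2} (hq : q ∈ U) : dirDeriv X u q = dirDeriv X v q := by
  unfold dirDeriv
  rw [Filter.EventuallyEq.fderiv_eq (𝕜 := ℝ) (Filter.eventually_of_mem (hU.mem_nhds hq) h)]

lemma dirDeriv_smul (X : E2 → E2) {c : E2 → ℝ} {u : E2 → V} {q : E2}
    (hc : DifferentiableAt ℝ c q) (hu : DifferentiableAt ℝ u q) :
    dirDeriv X (fun q => c q • u q) q = dirDeriv X c q • u q + c q • dirDeriv X u q := by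
  unfold dirDeriv
  rw [fderiv_fun_smul hc hu]
  simp [add_comm]

lemma dirDeriv_add (X : E2 → E2) {u v : E2 → V} {q : E2}
    (hu : DifferentiableAt ℝ u q) (hv : DifferentiableAt ℝ v q) :
    dirDeriv X (fun q => u q + v q) q = dirDeriv X u q + dirDeriv X v q := by
  simp [dirDeriv, fderiv_fun_add hu hv]

lemma dirDeriv_sub (X : E2 → E2) {u v : E2 → V} {q : E2}
    (hu : DifferentiableAt ℝ u q) (hv : DifferentiableAt ℝ v q) :
    dirDeriv X (fun q => u q - v q) q = dirDeriv X u q - dirDeriv X v q := by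
  simp [dirDeriv, fderiv_fun_sub hu hv]

lemma dirDeriv_mul (X : E2 → E2) {c u : E2 → ℝ} {q : E2}
    (hc : DifferentiableAt ℝ c q) (hu : DifferentiableAt ℝ u q) :
    dirDeriv X (fun q => c q * u q) q = dirDeriv X c q * u q + c q * dirDeriv X u q :=
  dirDeriv_smul X hc hu

/-- Iterated derivatives along vector fields in terms of the second derivative. -/
lemma dirDeriv_dirDeriv {X Y : E2 → E2} {u : E2 → V} {q : E2}
    (hu : ContDiffAt ℝ 2 u q) (hY : DifferentiableAt ℝ Y q) :
    dirDeriv X (dirDeriv Y u) q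
      = fderiv ℝ (fderiv ℝ u) q (X q) (Y q) + fderiv ℝ u q (fderiv ℝ Y q (X q)) := by
  have h1 : DifferentiableAt ℝ (fderiv ℝ u) q :=
    (hu.fderiv_right (m := 1) (by norm_num)).differentiableAt (by simp)
  have h2 : dirDeriv Y u = fun q => fderiv ℝ u q (Y q) := rfl
  rw [h2]
  unfold dirDeriv
  rw [fderiv_clm_apply h1 hY]
  simp [add_comm]

/-- The commutator of two vector fields, acting on functions. -/
lemma dirDeriv_commutator {X Y : E2 → E2} {u : E2 → V} {q : E2}
    (hu : ContDiffAt ℝ 2 u q) (hX : DifferentiableAt ℝ X q) (hY : DifferentiableAt ℝ Y q) :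
    dirDeriv X (dirDeriv Y u) q - dirDeriv Y (dirDeriv X u) q
      = fderiv ℝ u q (fderiv ℝ Y q (X q) - fderiv ℝ X q (Y q)) := by
  rw [dirDeriv_dirDeriv hu hY, dirDeriv_dirDeriv hu hX, map_sub,
    (hu.isSymmSndFDerivAt (by simp)).eq (X q) (Y q)]
  abel

/-- Differentiating a constant inner product. -/
lemma inner_fderiv_add_eq_zero {u v : E2 → E4} {q : E2} {c : ℝ} (hu : DifferentiableAt ℝ u q)
    (hv : DifferentiableAt ℝ v q) (h : ∀ᶠ z in 𝓝 q, ⟪u z, v z⟫ = c) (w : E2) :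
    ⟪u q, fderiv ℝ v q w⟫ + ⟪fderiv ℝ u q w, v q⟫ = 0 := by
  rw [← fderiv_inner_apply ℝ hu hv w]
  have : (fun t => ⟪u t, v t⟫) =ᶠ[𝓝 q] fun _ => c := h
  rw [this.fderiv_eq]
  simp

end DirectionalDerivative

/-! ### Surface patches in the sphere and principal moving frames. -/

/-- Four orthonormal vectors of `ℝ⁴` form a basis. -/
lemma eq_sum_of_orthonormal {f : Fin 4 → E4} (hf : Orthonormal ℝ f) (x : E4) :
    x = ∑ i, ⟪f i, x⟫ • f i := by
  have hs : ⊤ ≤ Submodule.span ℝ (Set.range f) := by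
    rw [hf.linearIndependent.span_eq_top_of_card_eq_finrank' (by simp)]
  simpa using ((OrthonormalBasis.mk hf hs).sum_repr' x).symm

/-- A patch `G` of an immersed surface in `S³`, with unit normal `N`, over an open set `U`. -/
structure IsPatch (U : Set E2) (G N : E2 → E4) : Prop where
  isOpen : IsOpen U
  smooth_G : ContDiffOn ℝ ∞ G U
  smooth_N : ContDiffOn ℝ ∞ N U
  injective : ∀ q ∈ U, Function.Injective (fderiv ℝ G q)
  inner_GG : ∀ q ∈ U, ⟪G q, G q⟫ = 1
  inner_NN : ∀ q ∈ U, ⟪N q, N q⟫ = 1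
  inner_NG : ∀ q ∈ U, ⟪N q, G q⟫ = 0
  inner_N_fderiv : ∀ q ∈ U, ∀ w, ⟪N q, fderiv ℝ G q w⟫ = 0

namespace IsPatch

variable {U : Set E2} {G N : E2 → E4}

lemma mono (h : IsPatch U G N) {V : Set E2} (hV : IsOpen V) (hVU : V ⊆ U) : IsPatch V G N where
  isOpen := hV
  smooth_G := h.smooth_G.mono hVU
  smooth_N := h.smooth_N.mono hVU
  injective q hq := h.injective q (hVU hq)
  inner_GG q hq := h.inner_GG q (hVU hq)
  inner_NN q hq := h.inner_NN q (hVU hq)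
  inner_NG q hq := h.inner_NG q (hVU hq)
  inner_N_fderiv q hq := h.inner_N_fderiv q (hVU hq)

lemma inner_G_fderiv (h : IsPatch U G N) {q : E2} (hq : q ∈ U) (w : E2) :
    ⟪G q, fderiv ℝ G q w⟫ = 0 := by
  have hG := differentiableAt_of_contDiffOn h.isOpen h.smooth_G hq
  have := inner_fderiv_add_eq_zero hG hG
    (Filter.eventually_of_mem (h.isOpen.mem_nhds hq) h.inner_GG) w
  rw [real_inner_comm (G q) (fderiv ℝ G q w)] at this
  linarith

lemma orthonormal (h : IsPatch U G N) {q : E2} (hq : q ∈ U) {v w : E2}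
    (hvv : ⟪fderiv ℝ G q v, fderiv ℝ G q v⟫ = 1) (hvw : ⟪fderiv ℝ G q v, fderiv ℝ G q w⟫ = 0)
    (hww : ⟪fderiv ℝ G q w, fderiv ℝ G q w⟫ = 1) :
    Orthonormal ℝ ![fderiv ℝ G q v, fderiv ℝ G q w, N q, G q] := by
  have h1 := h.inner_G_fderiv hq v
  have h2 := h.inner_G_fderiv hq w
  have h3 := h.inner_N_fderiv q hq v
  have h4 := h.inner_N_fderiv q hq w
  have h5 := h.inner_NG q hq
  rw [orthonormal_iff_ite]
  intro i j
  fin_cases i <;> fin_cases j <;>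
    simp [h.inner_GG q hq, h.inner_NN q hq, hvv, hww, h5, hvw, -inner_self_eq_norm_sq_to_K] <;>
    first
    | assumption
    | (rw [real_inner_comm]; assumption)

end IsPatch

/-- A frame `X, Y` of principal directions, with principal curvatures `k` and `l`. -/
structure IsMovingFrame (U : Set E2) (G N : E2 → E4) (k l : E2 → ℝ) (X Y : E2 → E2) : Prop
    extends IsPatch U G N where
  smooth_k : ContDiffOn ℝ ∞ k U
  smooth_l : ContDiffOn ℝ ∞ l U
  smooth_X : ContDiffOn ℝ ∞ X U
  smooth_Y : ContDiffOn ℝ ∞ Y U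
  inner_XX : ∀ q ∈ U, ⟪dirDeriv X G q, dirDeriv X G q⟫ = 1
  inner_XY : ∀ q ∈ U, ⟪dirDeriv X G q, dirDeriv Y G q⟫ = 0
  inner_YY : ∀ q ∈ U, ⟪dirDeriv Y G q, dirDeriv Y G q⟫ = 1
  principal_X : ∀ q ∈ U, dirDeriv X N q = k q • dirDeriv X G q
  principal_Y : ∀ q ∈ U, dirDeriv Y N q = l q • dirDeriv Y G q

namespace IsMovingFrame

variable {U : Set E2} {G N : E2 → E4} {k l : E2 → ℝ} {X Y : E2 → E2}

/-- Interchanging the two vector fields of a frame. -/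
lemma swap (h : IsMovingFrame U G N k l X Y) : IsMovingFrame U G N l k Y X where
  toIsPatch := h.toIsPatch
  smooth_k := h.smooth_l
  smooth_l := h.smooth_k
  smooth_X := h.smooth_Y
  smooth_Y := h.smooth_X
  inner_XX := h.inner_YY
  inner_XY q hq := by rw [real_inner_comm]; exact h.inner_XY q hq
  inner_YY := h.inner_XX
  principal_X := h.principal_Y
  principal_Y := h.principal_X

lemma orthonormal_frame (h : IsMovingFrame U G N k l X Y) {q : E2} (hq : q ∈ U) :
    Orthonormal ℝ ![dirDeriv X G q, dirDeriv Y G q, N q, G q] :=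
  h.orthonormal hq (h.inner_XX q hq) (h.inner_XY q hq) (h.inner_YY q hq)

lemma smooth_dX (h : IsMovingFrame U G N k l X Y) : ContDiffOn ℝ ∞ (dirDeriv X G) U :=
  contDiffOn_dirDeriv h.isOpen h.smooth_X h.smooth_G

lemma expand (h : IsMovingFrame U G N k l X Y) {q : E2} (hq : q ∈ U) (x : E4) :
    x = ⟪dirDeriv X G q, x⟫ • dirDeriv X G q + ⟪dirDeriv Y G q, x⟫ • dirDeriv Y G q
      + ⟪N q, x⟫ • N q + ⟪G q, x⟫ • G q := by
  simpa [Fin.sum_univ_four] using eq_sum_of_orthonormal (h.orthonormal_frame hq) x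

/-- Comparing coefficients in the frame. -/
lemma coeff (h : IsMovingFrame U G N k l X Y) {q : E2} (hq : q ∈ U) {c d : Fin 4 → ℝ}
    (he : c 0 • dirDeriv X G q + c 1 • dirDeriv Y G q + c 2 • N q + c 3 • G q
      = d 0 • dirDeriv X G q + d 1 • dirDeriv Y G q + d 2 • N q + d 3 • G q) : c = d := by
  have h1 := Fintype.linearIndependent_iff.1 (h.orthonormal_frame hq).linearIndependent (c - d) (by
    simp only [Fin.sum_univ_four, Pi.sub_apply, sub_smul]
    simp only [Matrix.cons_val]
    rw [← sub_eq_zero] at he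
    rw [← he]; abel)
  ext i
  linarith [h1 i, Pi.sub_apply c d i]

end IsMovingFrame

/-! ### Structure equations of a principal frame: Gauss, Codazzi and the Simons identity. -/

/-- The connection coefficient `⟨∇_X X, Y⟩` of an orthonormal frame of the surface `G`. -/
def conn (G : E2 → E4) (X Y : E2 → E2) (q : E2) : ℝ :=
  ⟪dirDeriv X (dirDeriv X G) q, dirDeriv Y G q⟫

namespace IsMovingFrame

variable {U : Set E2} {G N : E2 → E4} {k l : E2 → ℝ} {X Y : E2 → E2}

lemma smooth_conn (h : IsMovingFrame U G N k l X Y) : ContDiffOn ℝ ∞ (conn G X Y) U :=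
  (contDiffOn_dirDeriv h.isOpen h.smooth_X h.smooth_dX).inner ℝ h.swap.smooth_dX

/-- Each component comes from differentiating a constant inner product along `X`: unit length
removes the `X` component, while `⟨N, XG⟩ = 0` and `⟨G, XG⟩ = 0` give the coefficients `-k` and
`-1`, the second fundamental forms of the surface in `S³` and of `S³` in `ℝ⁴`. -/
lemma dirDeriv_X_X (h : IsMovingFrame U G N k l X Y) {q : E2} (hq : q ∈ U) :
    dirDeriv X (dirDeriv X G) q = conn G X Y q • dirDeriv Y G q - k q • N q - G q := by
  have hU := h.isOpen.mem_nhds hq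
  have d1 := differentiableAt_of_contDiffOn h.isOpen h.smooth_dX hq
  have dG := differentiableAt_of_contDiffOn h.isOpen h.smooth_G hq
  have dN := differentiableAt_of_contDiffOn h.isOpen h.smooth_N hq
  have e1 : ⟪dirDeriv X G q, dirDeriv X (dirDeriv X G) q⟫ = 0 := by
    have := inner_fderiv_add_eq_zero d1 d1 (eventually_of_mem hU h.inner_XX) (X q)
    rw [real_inner_comm (dirDeriv X G q) (fderiv ℝ (dirDeriv X G) q (X q))] at this
    unfold dirDeriv at this ⊢
    linarith
  have e2 : ⟪N q, dirDeriv X (dirDeriv X G) q⟫ = -k q := by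
    have := inner_fderiv_add_eq_zero dN d1
      (eventually_of_mem hU fun z hz => h.inner_N_fderiv z hz (X z)) (X q)
    change _ + ⟪dirDeriv X N q, _⟫ = 0 at this
    rw [h.principal_X q hq, real_inner_smul_left, h.inner_XX q hq] at this
    change ⟪N q, fderiv ℝ (dirDeriv X G) q (X q)⟫ = _
    linarith
  have e3 : ⟪G q, dirDeriv X (dirDeriv X G) q⟫ = -1 := by
    have := inner_fderiv_add_eq_zero dG d1
      (eventually_of_mem hU fun z hz => h.inner_G_fderiv hz (X z)) (X q)
    change _ + ⟪dirDeriv X G q, _⟫ = 0 at this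
    rw [h.inner_XX q hq] at this
    change ⟪G q, fderiv ℝ (dirDeriv X G) q (X q)⟫ = _
    linarith
  rw [h.expand hq (dirDeriv X (dirDeriv X G) q), e1, e2, e3,
    real_inner_comm (dirDeriv X (dirDeriv X G) q) (dirDeriv Y G q)]
  unfold conn
  module

/-- Nothing normal appears: `X` is principal and orthogonal to `Y`, so both second fundamental forms
vanish on the pair. The surviving component is minus the connection coefficient because `⟨XG, YG⟩`
is constant. -/
lemma dirDeriv_X_Y (h : IsMovingFrame U G N k l X Y) {q : E2} (hq : q ∈ U) :
    dirDeriv X (dirDeriv Y G) q = -conn G X Y q • dirDeriv X G q := by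
  have hU := h.isOpen.mem_nhds hq
  have d1 := differentiableAt_of_contDiffOn h.isOpen h.smooth_dX hq
  have d2 := differentiableAt_of_contDiffOn h.isOpen h.swap.smooth_dX hq
  have dG := differentiableAt_of_contDiffOn h.isOpen h.smooth_G hq
  have dN := differentiableAt_of_contDiffOn h.isOpen h.smooth_N hq
  have e0 : ⟪dirDeriv X G q, dirDeriv X (dirDeriv Y G) q⟫ = -conn G X Y q := by
    have := inner_fderiv_add_eq_zero d1 d2 (eventually_of_mem hU h.inner_XY) (X q)
    exact eq_neg_of_add_eq_zero_left this
  have e1 : ⟪dirDeriv Y G q, dirDeriv X (dirDeriv Y G) q⟫ = 0 := by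
    have := inner_fderiv_add_eq_zero d2 d2 (eventually_of_mem hU h.inner_YY) (X q)
    rw [real_inner_comm (dirDeriv Y G q) (fderiv ℝ (dirDeriv Y G) q (X q))] at this
    change ⟪dirDeriv Y G q, fderiv ℝ (dirDeriv Y G) q (X q)⟫ = 0
    linarith
  have e2 : ⟪N q, dirDeriv X (dirDeriv Y G) q⟫ = 0 := by
    have := inner_fderiv_add_eq_zero dN d2
      (eventually_of_mem hU fun z hz => h.inner_N_fderiv z hz (Y z)) (X q)
    change _ + ⟪dirDeriv X N q, _⟫ = 0 at this
    rw [h.principal_X q hq, real_inner_smul_left, h.inner_XY q hq] at this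
    change ⟪N q, fderiv ℝ (dirDeriv Y G) q (X q)⟫ = _
    linarith
  have e3 : ⟪G q, dirDeriv X (dirDeriv Y G) q⟫ = 0 := by
    have := inner_fderiv_add_eq_zero dG d2
      (eventually_of_mem hU fun z hz => h.inner_G_fderiv hz (Y z)) (X q)
    change _ + ⟪dirDeriv X G q, _⟫ = 0 at this
    rw [h.inner_XY q hq] at this
    change ⟪G q, fderiv ℝ (dirDeriv Y G) q (X q)⟫ = _
    linarith
  rw [h.expand hq (dirDeriv X (dirDeriv Y G) q), e0, e1, e2, e3]
  module

/-- The Levi-Civita connection is torsion free. -/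
lemma commutator (h : IsMovingFrame U G N k l X Y) {q : E2} (hq : q ∈ U) :
    fderiv ℝ Y q (X q) - fderiv ℝ X q (Y q) = -conn G X Y q • X q + conn G Y X q • Y q := by
  -- Since `dG` is injective, it suffices to compare images under `dG`, and there the bracket is the
  -- commutator of iterated derivatives of `G` itself.
  apply h.injective q hq
  have hG : ContDiffAt ℝ 2 G q :=
    (h.smooth_G.contDiffAt (h.isOpen.mem_nhds hq)).of_le (WithTop.coe_le_coe.2 le_top)
  rw [← dirDeriv_commutator hG (differentiableAt_of_contDiffOn h.isOpen h.smooth_X hq)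
    (differentiableAt_of_contDiffOn h.isOpen h.smooth_Y hq), h.dirDeriv_X_Y hq,
    h.swap.dirDeriv_X_Y hq, map_add, map_smul, map_smul]
  unfold dirDeriv
  module

lemma dirDeriv_comm (h : IsMovingFrame U G N k l X Y) {V : Type*} [NormedAddCommGroup V]
    [NormedSpace ℝ V] {u : E2 → V} (hu : ContDiffOn ℝ ∞ u U) {q : E2} (hq : q ∈ U) :
    dirDeriv X (dirDeriv Y u) q - dirDeriv Y (dirDeriv X u) q
      = -conn G X Y q • dirDeriv X u q + conn G Y X q • dirDeriv Y u q := by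
  have hu' : ContDiffAt ℝ 2 u q :=
    (hu.contDiffAt (h.isOpen.mem_nhds hq)).of_le (WithTop.coe_le_coe.2 le_top)
  rw [dirDeriv_commutator hu' (differentiableAt_of_contDiffOn h.isOpen h.smooth_X hq)
    (differentiableAt_of_contDiffOn h.isOpen h.smooth_Y hq), h.commutator hq, map_add, map_smul,
    map_smul]
  rfl

/-- The Codazzi equation. -/
lemma codazzi (h : IsMovingFrame U G N k l X Y) {q : E2} (hq : q ∈ U) :
    dirDeriv Y k q = conn G X Y q * (k q - l q) := by
  have d1 := differentiableAt_of_contDiffOn h.isOpen h.smooth_dX hq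
  have d2 := differentiableAt_of_contDiffOn h.isOpen h.swap.smooth_dX hq
  have dk := differentiableAt_of_contDiffOn h.isOpen h.smooth_k hq
  have dl := differentiableAt_of_contDiffOn h.isOpen h.smooth_l hq
  -- Codazzi is the commutator relation applied to `N`, read off in the component along `XG`.
  have key := h.dirDeriv_comm h.smooth_N hq
  rw [dirDeriv_congr h.isOpen X h.principal_Y hq, dirDeriv_congr h.isOpen Y h.principal_X hq,
    dirDeriv_smul X dl d2, dirDeriv_smul Y dk d1, h.dirDeriv_X_Y hq, h.swap.dirDeriv_X_Y hq,
    h.principal_X q hq, h.principal_Y q hq] at key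
  have := h.coeff hq
    (c := ![-(l q * conn G X Y q) - dirDeriv Y k q, dirDeriv X l q + k q * conn G Y X q, 0, 0])
    (d := ![-(conn G X Y q * k q), conn G Y X q * l q, 0, 0]) (by
      simp only [Matrix.cons_val]
      rw [← sub_eq_zero] at key ⊢
      rw [← key]
      module)
  have := congrFun this 0
  simp only [Matrix.cons_val] at this
  linarith

/-- The Gauss equation. -/
lemma gauss (h : IsMovingFrame U G N k l X Y) {q : E2} (hq : q ∈ U) :
    dirDeriv X (conn G Y X) q + dirDeriv Y (conn G X Y) q
      = conn G X Y q ^ 2 + conn G Y X q ^ 2 + 1 + k q * l q := by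
  have d1 := differentiableAt_of_contDiffOn h.isOpen h.smooth_dX hq
  have d2 := differentiableAt_of_contDiffOn h.isOpen h.swap.smooth_dX hq
  have dk := differentiableAt_of_contDiffOn h.isOpen h.smooth_k hq
  have dN := differentiableAt_of_contDiffOn h.isOpen h.smooth_N hq
  have dG := differentiableAt_of_contDiffOn h.isOpen h.smooth_G hq
  have da := differentiableAt_of_contDiffOn h.isOpen h.smooth_conn hq
  have db := differentiableAt_of_contDiffOn h.isOpen h.swap.smooth_conn hq
  -- Gauss is the commutator relation applied to `XG`, read off in the component along `YG`. The
  -- terms `k l` and `1` come from differentiating `-k N` and `-G` along `Y`.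
  have key := h.dirDeriv_comm h.smooth_dX hq
  have e1 : dirDeriv X (fun q => -conn G Y X q) q = -dirDeriv X (conn G Y X) q := by
    simp [dirDeriv, fderiv_fun_neg]
  rw [dirDeriv_congr h.isOpen X (fun z hz => h.swap.dirDeriv_X_Y hz) hq,
    dirDeriv_congr h.isOpen Y (fun z hz => h.dirDeriv_X_X hz) hq,
    dirDeriv_smul X (c := fun q => -conn G Y X q) db.neg d2, e1,
    dirDeriv_sub Y (u := fun q => conn G X Y q • dirDeriv Y G q - k q • N q)
      ((da.smul d2).sub (dk.smul dN)) dG,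
    dirDeriv_sub Y (u := fun q => conn G X Y q • dirDeriv Y G q) (v := fun q => k q • N q)
      (da.smul d2) (dk.smul dN), dirDeriv_smul Y da d2, dirDeriv_smul Y dk dN,
    h.dirDeriv_X_Y hq, h.swap.dirDeriv_X_Y hq, h.dirDeriv_X_X hq, h.swap.dirDeriv_X_X hq,
    h.principal_Y q hq] at key
  have := h.coeff hq
    (c := ![0, -dirDeriv X (conn G Y X) q - dirDeriv Y (conn G X Y) q + k q * l q + 1,
      dirDeriv Y k q + conn G X Y q * l q, conn G X Y q])
    (d := ![0, -(conn G X Y q ^ 2) - conn G Y X q ^ 2, conn G X Y q * k q, conn G X Y q]) (by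
      simp only [Matrix.cons_val]
      rw [← sub_eq_zero] at key ⊢
      rw [← key]
      module)
  have := congrFun this 1
  simp only [Matrix.cons_val] at this
  linarith

/-- A Simons type identity for a principal curvature, when both principal curvatures satisfy
`dk + dl = s (dk - dl)` with `ds = c (dk - dl)`. -/
lemma simons (h : IsMovingFrame U G N k l X Y) {p : E2} (hp : p ∈ U) {s : E2 → ℝ} {c : ℝ}
    (hs : DifferentiableAt ℝ s p) (hds : ∀ w, fderiv ℝ s p w = c * (fderiv ℝ k p w - fderiv ℝ l p w))
    (hW : ∀ᶠ q in 𝓝 p, ∀ w,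
      fderiv ℝ k q w + fderiv ℝ l q w = s q * (fderiv ℝ k q w - fderiv ℝ l q w))
    (hkl : k p ≠ l p) (h0 : 1 - s p ≠ 0) :
    (1 - s p) * (dirDeriv X (dirDeriv X k) p - conn G X Y p * dirDeriv Y k p)
      + (1 + s p) * (dirDeriv Y (dirDeriv Y k) p - conn G Y X p * dirDeriv X k p)
      + ((1 - s p) * (k p ^ 2 - 1) + (1 + s p) * (l p ^ 2 - 1)) * k p
      - ((1 - s p) * k p + (1 + s p) * l p) * (k p ^ 2 - 1)
    = 2 * ((1 + s p) / (k p - l p)) * (dirDeriv X l p ^ 2 + dirDeriv Y k p ^ 2)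
      + c * ((1 - s p + (1 + s p)) ^ 2 / (1 - s p) ^ 2) * dirDeriv X l p ^ 2 := by
  have dk := differentiableAt_of_contDiffOn h.isOpen h.smooth_k hp
  have dl := differentiableAt_of_contDiffOn h.isOpen h.smooth_l hp
  have da := differentiableAt_of_contDiffOn h.isOpen h.smooth_conn hp
  have db := differentiableAt_of_contDiffOn h.isOpen h.swap.smooth_conn hp
  have dXk := differentiableAt_of_contDiffOn h.isOpen
    (contDiffOn_dirDeriv h.isOpen h.smooth_X h.smooth_k) hp
  have dXl := differentiableAt_of_contDiffOn h.isOpen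
    (contDiffOn_dirDeriv h.isOpen h.smooth_X h.smooth_l) hp
  have hg := h.gauss hp
  have ha := h.codazzi hp
  have hb := h.swap.codazzi hp
  have hWX : dirDeriv X k p + dirDeriv X l p = s p * (dirDeriv X k p - dirDeriv X l p) :=
    hW.self_of_nhds (X p)
  have hWY : dirDeriv Y k p + dirDeriv Y l p = s p * (dirDeriv Y k p - dirDeriv Y l p) :=
    hW.self_of_nhds (Y p)
  have hsX : dirDeriv X s p = c * (dirDeriv X k p - dirDeriv X l p) := hds (X p)
  -- Codazzi holds on all of `U`, so it may be differentiated once more; this expresses `YYk` and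
  -- `XXl` through derivatives of the connection coefficients.
  have hYY : dirDeriv Y (dirDeriv Y k) p = dirDeriv Y (conn G X Y) p * (k p - l p)
      + conn G X Y p * (dirDeriv Y k p - dirDeriv Y l p) := by
    rw [dirDeriv_congr h.isOpen Y (fun z hz => h.codazzi hz) hp, dirDeriv_mul Y (u := fun q => k q - l q) da (dk.sub dl),
      dirDeriv_sub Y dk dl]
  have hXl : dirDeriv X (dirDeriv X l) p = dirDeriv X (conn G Y X) p * (l p - k p)
      + conn G Y X p * (dirDeriv X l p - dirDeriv X k p) := by
    rw [dirDeriv_congr h.isOpen X (fun z hz => h.swap.codazzi hz) hp, dirDeriv_mul X (u := fun q => l q - k q) db (dl.sub dk),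
      dirDeriv_sub X dl dk]
  -- The relation `hW` holds near `p`, so its `X` component can be differentiated again along `X`.
  -- The derivative of `s` then contributes the term with `c`.
  have hXX : dirDeriv X (dirDeriv X k) p + dirDeriv X (dirDeriv X l) p
      = dirDeriv X s p * (dirDeriv X k p - dirDeriv X l p)
        + s p * (dirDeriv X (dirDeriv X k) p - dirDeriv X (dirDeriv X l) p) := by
    rw [← dirDeriv_add X dXk dXl, ← dirDeriv_sub X dXk dXl,
      ← dirDeriv_mul X (u := fun q => dirDeriv X k q - dirDeriv X l q) hs (dXk.sub dXl)]
    unfold dirDeriv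
    rw [Filter.EventuallyEq.fderiv_eq (𝕜 := ℝ)]
    exact hW.mono fun q hq => hq (X q)
  rw [hsX] at hXX
  have hd : k p - l p ≠ 0 := sub_ne_zero.2 hkl
  generalize dirDeriv X (dirDeriv X k) p = Xk2 at *
  generalize dirDeriv X (dirDeriv X l) p = Xl2 at *
  generalize dirDeriv Y (dirDeriv Y k) p = Yk2 at *
  generalize dirDeriv X (conn G Y X) p = XB at *
  generalize dirDeriv Y (conn G X Y) p = YA at *
  generalize dirDeriv X k p = Xk at *
  generalize dirDeriv X l p = Xl at *
  generalize dirDeriv Y k p = Yk at *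
  generalize dirDeriv Y l p = Yl at *
  generalize conn G X Y p = A at *
  generalize conn G Y X p = B at *
  generalize k p = K at *
  generalize l p = L at *
  generalize s p = t at *
  have hYA : YA = A ^ 2 + B ^ 2 + 1 + K * L - XB := by linarith
  have hXk : Xk = -(1 + t) * Xl / (1 - t) := by
    field_simp; linarith
  have hXkl : Xk - Xl = -(1 - t + (1 + t)) / (1 - t) * Xl := by
    rw [hXk]; field_simp; ring
  have hX2 : (1 - t) * Xk2 = c * (Xk - Xl) ^ 2 - (1 + t) * Xl2 := by linarith
  have hc : c * (Xk - Xl) ^ 2 = c * ((1 - t + (1 + t)) ^ 2 / (1 - t) ^ 2) * Xl ^ 2 := by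
    rw [hXkl]; field_simp
  -- Codazzi turns the gradient term into the connection coefficients, cancelling the denominator.
  have hq : 2 * ((1 + t) / (K - L)) * (Xl ^ 2 + Yk ^ 2) = 2 * (1 + t) * (K - L) * (A ^ 2 + B ^ 2) := by
    rw [hb, ha]; field_simp; ring
  rw [hq, ← hc]
  have hY : A * ((1 + t) * Yl) = -(A * (1 - t) * Yk) := by linear_combination A * hWY
  subst hYA hXl hYY
  rw [ha] at *
  rw [hb] at *
  -- The Gauss term `(1 + t)(K - L)(1 + K L)` cancels against the zeroth order terms; the remaining
  -- multiples of `A²` and `B²` add up to `hq`.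
  linear_combination hX2 - hY
end IsMovingFrame

/-! ### Principal curvatures as roots of the characteristic polynomial. -/

/-- Coefficients of the first (`N = G`) and second fundamental form of a patch. -/
def coef (G N : E2 → E4) (i j : Fin 2) (q : E2) : ℝ := ⟪pd i N q, pd j G q⟫

/-- The determinant of the metric. -/
def gram (G : E2 → E4) (q : E2) : ℝ :=
  coef G G 0 0 q * coef G G 1 1 q - coef G G 0 1 q ^ 2

/-- The trace of the shape operator. -/
def shapeTrace (G N : E2 → E4) (q : E2) : ℝ :=
  (coef G G 1 1 q * coef G N 0 0 q + coef G G 0 0 q * coef G N 1 1 q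
    - 2 * coef G G 0 1 q * coef G N 0 1 q) / gram G q

/-- The determinant of the shape operator. -/
def shapeDet (G N : E2 → E4) (q : E2) : ℝ :=
  (coef G N 0 0 q * coef G N 1 1 q - coef G N 0 1 q ^ 2) / gram G q

/-- The discriminant of the characteristic polynomial of the shape operator. -/
def shapeDisc (G N : E2 → E4) (q : E2) : ℝ := shapeTrace G N q ^ 2 - 4 * shapeDet G N q

/-- The roots of the characteristic polynomial of the shape operator, for `ε = ±1`. -/
def curv (G N : E2 → E4) (ε : ℝ) (q : E2) : ℝ :=
  (shapeTrace G N q + ε * √(shapeDisc G N q)) / 2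

/-- The eigenvalue condition for the second fundamental form with respect to the first one. -/
def IsEigen (G N : E2 → E4) (q : E2) (κ : ℝ) (v : E2) : Prop :=
  ∀ w, ⟪fderiv ℝ N q v, fderiv ℝ G q w⟫ = κ * ⟪fderiv ℝ G q v, fderiv ℝ G q w⟫

lemma fderiv_eq_pd {V : Type*} [NormedAddCommGroup V] [NormedSpace ℝ V] (u : E2 → V) (q w : E2) :
    fderiv ℝ u q w = w 0 • pd 0 u q + w 1 • pd 1 u q := by
  have : w = w 0 • EuclideanSpace.single 0 1 + w 1 • EuclideanSpace.single 1 1 := by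
    ext i; fin_cases i <;> simp
  conv_lhs => rw [this]
  simp [pd]

lemma inner_fderiv_fderiv (G N : E2 → E4) (q v w : E2) :
    ⟪fderiv ℝ N q v, fderiv ℝ G q w⟫ = w 0 * (coef G N 0 0 q * v 0 + coef G N 1 0 q * v 1)
      + w 1 * (coef G N 0 1 q * v 0 + coef G N 1 1 q * v 1) := by
  rw [fderiv_eq_pd N, fderiv_eq_pd G]
  simp only [inner_add_left, inner_add_right, real_inner_smul_left, real_inner_smul_right, coef]
  ring

lemma coef_self_comm (G : E2 → E4) (q : E2) : coef G G 1 0 q = coef G G 0 1 q :=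
  real_inner_comm _ _

namespace IsPatch

variable {U : Set E2} {G N : E2 → E4}

/-- Differentiating `⟨N, dG(w)⟩ = 0` along `v` shows that the form equals `-⟨N, D²G(v, w)⟩`, and
second derivatives are symmetric. -/
lemma inner_fderiv_symm (h : IsPatch U G N) {q : E2} (hq : q ∈ U) (v w : E2) :
    ⟪fderiv ℝ N q v, fderiv ℝ G q w⟫ = ⟪fderiv ℝ N q w, fderiv ℝ G q v⟫ := by
  have hG : ContDiffAt ℝ 2 G q :=
    (h.smooth_G.contDiffAt (h.isOpen.mem_nhds hq)).of_le (WithTop.coe_le_coe.2 le_top)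
  have dN := differentiableAt_of_contDiffOn h.isOpen h.smooth_N hq
  have dG : DifferentiableAt ℝ (fderiv ℝ G) q :=
    (hG.fderiv_right (m := 1) (by norm_num)).differentiableAt (by simp)
  have key (v w : E2) :
      ⟪N q, fderiv ℝ (fderiv ℝ G) q v w⟫ + ⟪fderiv ℝ N q v, fderiv ℝ G q w⟫ = 0 := by
    have := inner_fderiv_add_eq_zero dN (dG.clm_apply (differentiableAt_const w))
      (eventually_of_mem (h.isOpen.mem_nhds hq) fun z hz => h.inner_N_fderiv z hz w) v
    rw [fderiv_clm_apply dG (differentiableAt_const w)] at this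
    simpa using this
  have h1 := key v w
  have h2 := key w v
  rw [(hG.isSymmSndFDerivAt (by simp)).eq v w] at h1
  linarith

lemma coef_comm (h : IsPatch U G N) {q : E2} (hq : q ∈ U) : coef G N 1 0 q = coef G N 0 1 q :=
  h.inner_fderiv_symm hq _ _

lemma smooth_coef_self (h : IsPatch U G N) (i j : Fin 2) : ContDiffOn ℝ ∞ (coef G G i j) U :=
  (contDiffOn_dirDeriv h.isOpen contDiffOn_const h.smooth_G).inner ℝ
    (contDiffOn_dirDeriv h.isOpen contDiffOn_const h.smooth_G)

lemma smooth_coef (h : IsPatch U G N) (i j : Fin 2) : ContDiffOn ℝ ∞ (coef G N i j) U :=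
  (contDiffOn_dirDeriv h.isOpen contDiffOn_const h.smooth_N).inner ℝ
    (contDiffOn_dirDeriv h.isOpen contDiffOn_const h.smooth_G)

lemma eq_zero_of_inner_self (h : IsPatch U G N) {q : E2} (hq : q ∈ U) {v : E2}
    (hv : ⟪fderiv ℝ G q v, fderiv ℝ G q v⟫ = 0) : v = 0 :=
  h.injective q hq (by rw [inner_self_eq_zero.1 hv, map_zero])

lemma gram_pos (h : IsPatch U G N) {q : E2} (hq : q ∈ U) : 0 < gram G q := by
  have h0 : 0 < coef G G 0 0 q := by
    refine lt_of_le_of_ne real_inner_self_nonneg fun h0 => ?_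
    have := congrArg (fun v : E2 => v 0) (h.eq_zero_of_inner_self hq h0.symm)
    simp at this
  -- The squared length of `(-g₀₁, g₀₀)` is `g₀₀` times the determinant of the metric, which gives
  -- positivity without Cauchy–Schwarz.
  have h1 := inner_fderiv_fderiv G G q (!₂[-coef G G 0 1 q, coef G G 0 0 q])
    (!₂[-coef G G 0 1 q, coef G G 0 0 q])
  have h2 : 0 < ⟪fderiv ℝ G q !₂[-coef G G 0 1 q, coef G G 0 0 q],
      fderiv ℝ G q !₂[-coef G G 0 1 q, coef G G 0 0 q]⟫ := by
    refine lt_of_le_of_ne real_inner_self_nonneg fun h0' => ?_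
    have := congrArg (fun v : E2 => v 1) (h.eq_zero_of_inner_self hq h0'.symm)
    simp at this
    exact h0.ne' this
  rw [h1] at h2
  simp [coef_self_comm] at h2
  refine (mul_pos_iff_of_pos_left h0).1 ?_
  unfold gram
  linarith

lemma smooth_gram (h : IsPatch U G N) : ContDiffOn ℝ ∞ (gram G) U :=
  ((h.smooth_coef_self 0 0).mul (h.smooth_coef_self 1 1)).sub ((h.smooth_coef_self 0 1).pow 2)

lemma smooth_shapeTrace (h : IsPatch U G N) : ContDiffOn ℝ ∞ (shapeTrace G N) U :=
  ((((h.smooth_coef_self 1 1).mul (h.smooth_coef 0 0)).add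
    ((h.smooth_coef_self 0 0).mul (h.smooth_coef 1 1))).sub
    ((contDiffOn_const.mul (h.smooth_coef_self 0 1)).mul (h.smooth_coef 0 1))).div
    h.smooth_gram fun _ hq => (h.gram_pos hq).ne'

lemma smooth_shapeDisc (h : IsPatch U G N) : ContDiffOn ℝ ∞ (shapeDisc G N) U :=
  (h.smooth_shapeTrace.pow 2).sub (contDiffOn_const.mul
    ((((h.smooth_coef 0 0).mul (h.smooth_coef 1 1)).sub ((h.smooth_coef 0 1).pow 2)).div
    h.smooth_gram fun _ hq => (h.gram_pos hq).ne'))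

lemma smooth_curv (h : IsPatch U G N) (hd : ∀ q ∈ U, 0 < shapeDisc G N q) (ε : ℝ) :
    ContDiffOn ℝ ∞ (curv G N ε) U :=
  (h.smooth_shapeTrace.add (contDiffOn_const.mul
    (h.smooth_shapeDisc.sqrt fun q hq => (hd q hq).ne'))).div_const 2

/-- An eigenvector exists exactly when `h - κ g` is singular, and `det (h - κ g)` is `det g` times
the characteristic polynomial of the shape operator. -/
lemma exists_isEigen_iff (h : IsPatch U G N) {q : E2} (hq : q ∈ U) (κ : ℝ) :
    (∃ v ≠ 0, IsEigen G N q κ v) ↔ κ ^ 2 - shapeTrace G N q * κ + shapeDet G N q = 0 := by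
  have hg := (h.gram_pos hq).ne'
  set M : Matrix (Fin 2) (Fin 2) ℝ := !![coef G N 0 0 q - κ * coef G G 0 0 q,
    coef G N 0 1 q - κ * coef G G 0 1 q; coef G N 0 1 q - κ * coef G G 0 1 q,
    coef G N 1 1 q - κ * coef G G 1 1 q] with hM
  have hdet : M.det = gram G q * (κ ^ 2 - shapeTrace G N q * κ + shapeDet G N q) := by
    rw [hM, Matrix.det_fin_two_of]
    unfold shapeTrace shapeDet
    field_simp
    unfold gram
    ring
  have hv (v : E2) : IsEigen G N q κ v ↔ M.mulVec v.ofLp = 0 := by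
    unfold IsEigen
    simp only [inner_fderiv_fderiv, coef_self_comm, h.coef_comm hq]
    constructor
    · intro hw
      have h0 := hw (EuclideanSpace.single 0 1)
      have h1 := hw (EuclideanSpace.single 1 1)
      simp at h0 h1
      ext i
      fin_cases i <;> simp [hM, Matrix.mulVec, dotProduct, Fin.sum_univ_two] <;> linarith
    · intro hw w
      have h0 := congrFun hw 0
      have h1 := congrFun hw 1
      simp [hM, Matrix.mulVec, dotProduct, Fin.sum_univ_two] at h0 h1
      linear_combination w 0 * h0 + w 1 * h1
  rw [← mul_eq_zero_iff_left hg, ← hdet, ← Matrix.exists_mulVec_eq_zero_iff]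
  constructor
  · rintro ⟨v, hv0, hve⟩
    exact ⟨v.ofLp, fun h0 => hv0 (by ext i; simp [h0]), (hv v).1 hve⟩
  · rintro ⟨v, hv0, hve⟩
    exact ⟨WithLp.toLp 2 v, fun h0 => hv0 (by simpa using h0), (hv _).2 (by simpa using hve)⟩

end IsPatch

lemma curv_add (G N : E2 → E4) (ε : ℝ) (q : E2) :
    curv G N ε q + curv G N (-ε) q = shapeTrace G N q := by
  unfold curv; ring

lemma curv_mul {G N : E2 → E4} {ε : ℝ} (hε : ε ^ 2 = 1) {q : E2} (hd : 0 < shapeDisc G N q) :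
    curv G N ε q * curv G N (-ε) q = shapeDet G N q := by
  have h := Real.sq_sqrt hd.le
  have h2 : curv G N ε q * curv G N (-ε) q
      = (shapeTrace G N q ^ 2 - ε ^ 2 * √(shapeDisc G N q) ^ 2) / 4 := by
    unfold curv; ring
  rw [h2, h, hε, shapeDisc]
  ring

lemma curv_sub_pos {G N : E2 → E4} {q : E2} (hd : 0 < shapeDisc G N q) :
    curv G N (-1) q < curv G N 1 q := by
  have := Real.sqrt_pos.2 hd
  unfold curv
  linarith

lemma root_iff {G N : E2 → E4} {q : E2} (hd : 0 < shapeDisc G N q) (κ : ℝ) :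
    κ ^ 2 - shapeTrace G N q * κ + shapeDet G N q = 0
      ↔ κ = curv G N 1 q ∨ κ = curv G N (-1) q := by
  rw [← curv_add G N 1 q, ← curv_mul (ε := 1) (by norm_num) hd, ← sub_eq_zero (b := curv G N 1 q),
    ← sub_eq_zero (b := curv G N (-1) q), ← mul_eq_zero]
  constructor <;> intro h <;> linear_combination h

/-- Distinct eigenvalues have positive discriminant. -/
lemma shapeDisc_pos {G N : E2 → E4} {q : E2} {κ κ' : ℝ} (hne : κ ≠ κ')
    (h : κ ^ 2 - shapeTrace G N q * κ + shapeDet G N q = 0)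
    (h' : κ' ^ 2 - shapeTrace G N q * κ' + shapeDet G N q = 0) : 0 < shapeDisc G N q := by
  have hT : shapeTrace G N q = κ + κ' := by
    have : (κ - κ') * (shapeTrace G N q - (κ + κ')) = 0 := by linear_combination h' - h
    linarith [(mul_eq_zero.1 this).resolve_left (sub_ne_zero.2 hne)]
  have : shapeDisc G N q = (κ - κ') ^ 2 := by
    unfold shapeDisc
    rw [hT] at h ⊢
    linear_combination (-4) * h
  rw [this]
  have := sub_ne_zero.2 hne
  positivity

/-! ### Smooth fields of principal directions. -/

/-- The vector `adj(g) (h - κ g) u`. -/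
def eigenField (G N : E2 → E4) (κ : E2 → ℝ) (u : E2) (q : E2) : E2 :=
  !₂[coef G G 1 1 q * ((coef G N 0 0 q - κ q * coef G G 0 0 q) * u 0
        + (coef G N 0 1 q - κ q * coef G G 0 1 q) * u 1)
      - coef G G 0 1 q * ((coef G N 0 1 q - κ q * coef G G 0 1 q) * u 0
        + (coef G N 1 1 q - κ q * coef G G 1 1 q) * u 1),
    coef G G 0 0 q * ((coef G N 0 1 q - κ q * coef G G 0 1 q) * u 0
        + (coef G N 1 1 q - κ q * coef G G 1 1 q) * u 1)
      - coef G G 0 1 q * ((coef G N 0 0 q - κ q * coef G G 0 0 q) * u 0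
        + (coef G N 0 1 q - κ q * coef G G 0 1 q) * u 1)]

lemma IsEigen.smul {G N : E2 → E4} {q : E2} {κ : ℝ} {v : E2} (h : IsEigen G N q κ v) (c : ℝ) :
    IsEigen G N q κ (c • v) := fun w => by
  simp only [map_smul, real_inner_smul_left, h w]
  ring

namespace IsPatch

variable {U : Set E2} {G N : E2 → E4}

lemma smooth_eigenField (h : IsPatch U G N) {κ : E2 → ℝ} (hκ : ContDiffOn ℝ ∞ κ U) (u : E2) :
    ContDiffOn ℝ ∞ (eigenField G N κ u) U := by
  have h00 := h.smooth_coef_self 0 0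
  have h01 := h.smooth_coef_self 0 1
  have h11 := h.smooth_coef_self 1 1
  have k00 := (h.smooth_coef 0 0).sub (hκ.mul h00)
  have k01 := (h.smooth_coef 0 1).sub (hκ.mul h01)
  have k11 := (h.smooth_coef 1 1).sub (hκ.mul h11)
  have c0 : ContDiffOn ℝ ∞ (fun _ : E2 => u 0) U := contDiffOn_const
  have c1 : ContDiffOn ℝ ∞ (fun _ : E2 => u 1) U := contDiffOn_const
  have w0 := (k00.mul c0).add (k01.mul c1)
  have w1 := (k01.mul c0).add (k11.mul c1)
  rw [contDiffOn_piLp]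
  intro i
  fin_cases i
  · exact (h11.mul w0).sub (h01.mul w1)
  · exact (h00.mul w1).sub (h01.mul w0)

/-- With `S` the shape operator, `adj(g) (h - κ' g) = det g · (S - κ')`. By Cayley–Hamilton `(S -
κ)(S - κ') = 0`, so its image consists of eigenvectors for `κ`. The field may vanish, and being
polynomial in the data it is smooth. -/
lemma isEigen_eigenField (h : IsPatch U G N) {κ κ' : E2 → ℝ} {q : E2} (hq : q ∈ U)
    (hT : κ q + κ' q = shapeTrace G N q) (hD : κ q * κ' q = shapeDet G N q) (u : E2) :
    IsEigen G N q (κ q) (eigenField G N κ' u q) := by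
  have hg := (h.gram_pos hq).ne'
  unfold shapeTrace at hT
  unfold shapeDet at hD
  rw [eq_div_iff hg] at hT hD
  unfold gram at hT hD
  intro w
  rw [inner_fderiv_fderiv, inner_fderiv_fderiv, h.coef_comm hq, coef_self_comm]
  simp only [eigenField, Matrix.cons_val]
  linear_combination
    (-(w 0 * (coef G N 0 0 q * u 0 + coef G N 0 1 q * u 1)
      + w 1 * (coef G N 0 1 q * u 0 + coef G N 1 1 q * u 1))) * hT
    + (w 0 * (coef G G 0 0 q * u 0 + coef G G 0 1 q * u 1)
      + w 1 * (coef G G 0 1 q * u 0 + coef G G 1 1 q * u 1)) * hD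

/-- The operator `det g · (S - κ')` is a scalar on an eigenvector of `S`; this is what allows the
value of the field at one point to be prescribed. -/
lemma eigenField_of_isEigen (h : IsPatch U G N) {κ : ℝ} {κ' : E2 → ℝ} {q : E2} (hq : q ∈ U)
    {u : E2} (hu : IsEigen G N q κ u) :
    eigenField G N κ' u q = (gram G q * (κ - κ' q)) • u := by
  have h0 := hu (EuclideanSpace.single 0 1)
  have h1 := hu (EuclideanSpace.single 1 1)
  simp only [inner_fderiv_fderiv, coef_self_comm, h.coef_comm hq] at h0 h1
  simp at h0 h1
  unfold gram
  ext i
  fin_cases i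
  · simp [eigenField]
    linear_combination coef G G 1 1 q * h0 - coef G G 0 1 q * h1
  · simp [eigenField]
    linear_combination coef G G 0 0 q * h1 - coef G G 0 1 q * h0

/-- A unit principal direction at a point extends to a smooth field of unit principal directions. -/
lemma exists_unit_eigenField (h : IsPatch U G N) {κ κ' : E2 → ℝ} (hκ' : ContDiffOn ℝ ∞ κ' U)
    (hT : ∀ q ∈ U, κ q + κ' q = shapeTrace G N q) (hD : ∀ q ∈ U, κ q * κ' q = shapeDet G N q)
    {p : E2} (hp : p ∈ U) (hne : κ p ≠ κ' p) {e : E2} (he : IsEigen G N p (κ p) e)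
    (he1 : ⟪fderiv ℝ G p e, fderiv ℝ G p e⟫ = 1) :
    ∃ (V : Set E2) (X : E2 → E2), IsOpen V ∧ V ⊆ U ∧ p ∈ V ∧ ContDiffOn ℝ ∞ X V ∧ X p = e ∧
      ∀ q ∈ V, ⟪fderiv ℝ G q (X q), fderiv ℝ G q (X q)⟫ = 1 ∧ IsEigen G N q (κ q) (X q) := by
  -- The extra factor `κ p - κ' p` makes `Z p` the multiple `det g · (κ - κ')²` of `e`. This is
  -- positive whichever root is larger, so normalising returns `e` and not `-e`.
  set Z := eigenField G N κ' ((κ p - κ' p) • e) with hZ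
  have hZs : ContDiffOn ℝ ∞ Z U := h.smooth_eigenField hκ' _
  set n : E2 → ℝ := fun q => ⟪dirDeriv Z G q, dirDeriv Z G q⟫ with hn
  have hns : ContDiffOn ℝ ∞ n U :=
    (contDiffOn_dirDeriv h.isOpen hZs h.smooth_G).inner ℝ
      (contDiffOn_dirDeriv h.isOpen hZs h.smooth_G)
  have hsq : 0 < (κ p - κ' p) ^ 2 := by have := sub_ne_zero.2 hne; positivity
  have hc : 0 < gram G p * (κ p - κ' p) ^ 2 := mul_pos (h.gram_pos hp) hsq
  have hZp : Z p = (gram G p * (κ p - κ' p) ^ 2) • e := by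
    rw [hZ, h.eigenField_of_isEigen hp (he.smul _), smul_smul]
    ring_nf
  have hnp : n p = (gram G p * (κ p - κ' p) ^ 2) ^ 2 := by
    simp only [hn, dirDeriv, hZp, map_smul, real_inner_smul_left, real_inner_smul_right, he1]
    ring
  refine ⟨U ∩ n ⁻¹' Set.Ioi 0, fun q => (√(n q))⁻¹ • Z q,
    hns.continuousOn.isOpen_inter_preimage h.isOpen isOpen_Ioi, Set.inter_subset_left,
    ⟨hp, by rw [Set.mem_preimage, hnp]; exact pow_pos hc 2⟩, ?_, ?_, ?_⟩
  · have hn' := hns.mono (Set.inter_subset_left (t := n ⁻¹' Set.Ioi 0))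
    have hne0 : ∀ q ∈ U ∩ n ⁻¹' Set.Ioi 0, n q ≠ 0 := fun q hq => ne_of_gt hq.2
    exact ((hn'.sqrt hne0).inv fun q hq => (Real.sqrt_pos.2 hq.2).ne').smul
      (hZs.mono Set.inter_subset_left)
  · simp only [hnp, Real.sqrt_sq hc.le, hZp, smul_smul, inv_mul_cancel₀ hc.ne', one_smul]
  · rintro q ⟨hq, hq0⟩
    refine ⟨?_, (h.isEigen_eigenField hq (hT q hq) (hD q hq) _).smul _⟩
    have hs : √(n q) ≠ 0 := (Real.sqrt_pos.2 hq0).ne'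
    have hnq : ⟪fderiv ℝ G q (Z q), fderiv ℝ G q (Z q)⟫ = √(n q) ^ 2 :=
      (Real.sq_sqrt (le_of_lt hq0)).symm
    simp only [map_smul, real_inner_smul_left, real_inner_smul_right, hnq]
    field_simp

/-- Eigenvectors of the second fundamental form are eigenvectors of the differential of `N`. -/
lemma fderiv_eq_smul_of_isEigen (h : IsPatch U G N) {q : E2} (hq : q ∈ U) {v w : E2}
    (hvv : ⟪fderiv ℝ G q v, fderiv ℝ G q v⟫ = 1) (hvw : ⟪fderiv ℝ G q v, fderiv ℝ G q w⟫ = 0)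
    (hww : ⟪fderiv ℝ G q w, fderiv ℝ G q w⟫ = 1) {κ : ℝ} (hv : IsEigen G N q κ v) :
    fderiv ℝ N q v = κ • fderiv ℝ G q v := by
  have dN := differentiableAt_of_contDiffOn h.isOpen h.smooth_N hq
  have dG := differentiableAt_of_contDiffOn h.isOpen h.smooth_G hq
  have hU := h.isOpen.mem_nhds hq
  have e1 := hv v
  have e2 := hv w
  rw [hvv] at e1
  rw [hvw] at e2
  have e3 := inner_fderiv_add_eq_zero dN dN (eventually_of_mem hU h.inner_NN) v
  rw [real_inner_comm (N q) (fderiv ℝ N q v)] at e3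
  have e4 := inner_fderiv_add_eq_zero dN dG (eventually_of_mem hU h.inner_NG) v
  rw [h.inner_N_fderiv q hq] at e4
  have hx := eq_sum_of_orthonormal (h.orthonormal hq hvv hvw hww) (fderiv ℝ N q v)
  simp only [Fin.sum_univ_four, Matrix.cons_val] at hx
  have e3' : ⟪N q, fderiv ℝ N q v⟫ = 0 := by linarith
  have e4' : ⟪G q, fderiv ℝ N q v⟫ = 0 := by rw [real_inner_comm]; linarith
  rw [real_inner_comm] at e1 e2
  rw [e1, e2, e3', e4'] at hx
  rw [hx]
  simp

lemma inner_eq_zero_of_isEigen (h : IsPatch U G N) {q : E2} (hq : q ∈ U) {κ κ' : ℝ} (hne : κ ≠ κ')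
    {v w : E2} (hv : IsEigen G N q κ v) (hw : IsEigen G N q κ' w) :
    ⟪fderiv ℝ G q v, fderiv ℝ G q w⟫ = 0 := by
  have h1 := h.inner_fderiv_symm hq v w
  rw [hv w, hw v, real_inner_comm (fderiv ℝ G q v) (fderiv ℝ G q w)] at h1
  have h2 : (κ - κ') * ⟪fderiv ℝ G q v, fderiv ℝ G q w⟫ = 0 := by linarith
  exact (mul_eq_zero.1 h2).resolve_left (sub_ne_zero.2 hne)

/-- Near a point that is not umbilic there is a smooth frame of principal directions, extending
any given one at the point. -/
lemma exists_isMovingFrame (h : IsPatch U G N) {p : E2} (hp : p ∈ U)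
    (hd : ∀ q ∈ U, 0 < shapeDisc G N q) {e f : E2}
    (he : IsEigen G N p (curv G N 1 p) e) (hf : IsEigen G N p (curv G N (-1) p) f)
    (he1 : ⟪fderiv ℝ G p e, fderiv ℝ G p e⟫ = 1) (hf1 : ⟪fderiv ℝ G p f, fderiv ℝ G p f⟫ = 1) :
    ∃ (V : Set E2) (X Y : E2 → E2), p ∈ V ∧ V ⊆ U ∧ X p = e ∧ Y p = f ∧
      IsMovingFrame V G N (curv G N 1) (curv G N (-1)) X Y := by
  have hne : ∀ q ∈ U, curv G N 1 q ≠ curv G N (-1) q := fun q hq => (curv_sub_pos (hd q hq)).ne'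
  have hT (q : E2) := curv_add G N 1 q
  have hD (q : E2) (hq : q ∈ U) := curv_mul (ε := 1) (by norm_num) (hd q hq)
  obtain ⟨V, X, hV, hVU, hpV, hX, hXp, hXV⟩ := h.exists_unit_eigenField (h.smooth_curv hd (-1))
    (fun q _ => hT q) hD hp (hne p hp) he he1
  obtain ⟨W, Y, hW, hWU, hpW, hY, hYp, hYW⟩ := h.exists_unit_eigenField (h.smooth_curv hd 1)
    (fun q _ => (add_comm _ _).trans (hT q)) (fun q hq => (mul_comm _ _).trans (hD q hq)) hp
    (hne p hp).symm hf hf1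
  have hXY : ∀ q ∈ V ∩ W, ⟪fderiv ℝ G q (X q), fderiv ℝ G q (Y q)⟫ = 0 := fun q hq =>
    h.inner_eq_zero_of_isEigen (hVU hq.1) (hne q (hVU hq.1)) (hXV q hq.1).2 (hYW q hq.2).2
  have hP := h.mono (hV.inter hW) (Set.inter_subset_left.trans hVU)
  have hd' : ∀ q ∈ V ∩ W, 0 < shapeDisc G N q := fun q hq => hd q (hVU hq.1)
  exact ⟨V ∩ W, X, Y, ⟨hpV, hpW⟩, Set.inter_subset_left.trans hVU, hXp, hYp,
    { toIsPatch := hP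
      smooth_k := hP.smooth_curv hd' 1
      smooth_l := hP.smooth_curv hd' (-1)
      smooth_X := hX.mono Set.inter_subset_left
      smooth_Y := hY.mono Set.inter_subset_right
      inner_XX := fun q hq => (hXV q hq.1).1
      inner_XY := hXY
      inner_YY := fun q hq => (hYW q hq.2).1
      principal_X := fun q hq => hP.fderiv_eq_smul_of_isEigen hq (hXV q hq.1).1 (hXY q hq)
        (hYW q hq.2).1 (hXV q hq.1).2
      principal_Y := fun q hq => hP.fderiv_eq_smul_of_isEigen hq (hYW q hq.2).1
        (by rw [real_inner_comm]; exact hXY q hq) (hXV q hq.1).1 (hYW q hq.2).2 }⟩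

end IsPatch

/-! ### The Hessian in a principal frame. -/

section Hessian

variable {M : Type*} [TopologicalSpace M] [ChartedSpace E2 M] {F : M → S3} {x : M}

lemma pd_coef {G : E2 → E4} {q : E2} (hG : ContDiffAt ℝ 2 G q) (i j l : Fin 2) :
    pd i (coef G G j l) q
      = ⟪fderiv ℝ (fderiv ℝ G) q (EuclideanSpace.single i 1) (EuclideanSpace.single j 1),
          pd l G q⟫
        + ⟪pd j G q,
          fderiv ℝ (fderiv ℝ G) q (EuclideanSpace.single i 1) (EuclideanSpace.single l 1)⟫ := by
  have dG : DifferentiableAt ℝ (fderiv ℝ G) q :=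
    (hG.fderiv_right (m := 1) (by norm_num)).differentiableAt (by simp)
  have hp (j : Fin 2) : DifferentiableAt ℝ (pd j G) q := dG.clm_apply (differentiableAt_const _)
  have hpd (i j : Fin 2) : fderiv ℝ (pd j G) q (EuclideanSpace.single i 1)
      = fderiv ℝ (fderiv ℝ G) q (EuclideanSpace.single i 1) (EuclideanSpace.single j 1) := by
    change fderiv ℝ (fun q => fderiv ℝ G q _) q _ = _
    rw [fderiv_clm_apply dG (differentiableAt_const _)]
    simp
  change fderiv ℝ (fun q => ⟪pd j G q, pd l G q⟫) q (EuclideanSpace.single i 1) = _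
  rw [fderiv_inner_apply ℝ (hp j) (hp l), hpd, hpd]
  ring

/-- The Christoffel symbols as tangential components of second derivatives. -/
lemma christoffel_eq {q : E2} (hG : ContDiffAt ℝ 2 (inChart x (toE4 F)) q) (k i j : Fin 2) :
    christoffel F x k i j q = ∑ l, (metricMatrix F x q)⁻¹ k l *
      ⟪fderiv ℝ (fderiv ℝ (inChart x (toE4 F))) q (EuclideanSpace.single i 1)
        (EuclideanSpace.single j 1), pd l (inChart x (toE4 F)) q⟫ := by
  unfold christoffel
  rw [Finset.mul_sum]
  refine Finset.sum_congr rfl fun l _ => ?_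
  have hs := (hG.isSymmSndFDerivAt (by simp)).eq
  have e1 := pd_coef hG i j l
  have e2 := pd_coef hG j i l
  have e3 := pd_coef hG l i j
  rw [hs (EuclideanSpace.single j 1) (EuclideanSpace.single i 1)] at e2
  rw [hs (EuclideanSpace.single l 1) (EuclideanSpace.single i 1),
    hs (EuclideanSpace.single l 1) (EuclideanSpace.single j 1)] at e3
  change (1 / 2) * (_ * (pd i (coef _ _ j l) q + pd j (coef _ _ i l) q - pd l (coef _ _ i j) q)) = _
  -- Of the six terms, four cancel in pairs by symmetry of second derivatives; the two equal ones
  -- left absorb the factor `1 / 2`.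
  rw [e1, e2, e3, real_inner_comm (pd j (inChart x (toE4 F)) q)]
  ring

/-- The Hessian in terms of the tangential part `z` of the second derivative of the immersion. -/
lemma hessian_eq {U : Set E2} {N : E2 → E4} (h : IsPatch U (inChart x (toE4 F)) N)
    (hp : extChartAt (𝓡 2) x x ∈ U) {f : M → ℝ}
    (hf : ContDiffAt ℝ 2 (inChart x f) (extChartAt (𝓡 2) x x)) {u v z : E2}
    (hz : ∀ w, ⟪fderiv ℝ (inChart x (toE4 F)) (extChartAt (𝓡 2) x x) z,
        fderiv ℝ (inChart x (toE4 F)) (extChartAt (𝓡 2) x x) w⟫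
      = ⟪fderiv ℝ (fderiv ℝ (inChart x (toE4 F))) (extChartAt (𝓡 2) x x) u v,
        fderiv ℝ (inChart x (toE4 F)) (extChartAt (𝓡 2) x x) w⟫) :
    hessian F f x u v = fderiv ℝ (fderiv ℝ (inChart x f)) (extChartAt (𝓡 2) x x) u v
      - fderiv ℝ (inChart x f) (extChartAt (𝓡 2) x x) z := by
  unfold hessian
  simp only
  generalize extChartAt (𝓡 2) x x = p at *
  generalize inChart x f = φ at *
  have hG : ContDiffAt ℝ 2 (inChart x (toE4 F)) p :=
    (h.smooth_G.contDiffAt (h.isOpen.mem_nhds hp)).of_le (WithTop.coe_le_coe.2 le_top)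
  have dφ : DifferentiableAt ℝ (fderiv ℝ φ) p :=
    (hf.fderiv_right (m := 1) (by norm_num)).differentiableAt (by simp)
  have hpp (i j : Fin 2) : pd i (pd j φ) p
      = fderiv ℝ (fderiv ℝ φ) p (EuclideanSpace.single i 1) (EuclideanSpace.single j 1) := by
    change fderiv ℝ (fun q => fderiv ℝ φ q _) p _ = _
    rw [fderiv_clm_apply dφ (differentiableAt_const _)]
    simp
  have hsum {V : Type} [NormedAddCommGroup V] [NormedSpace ℝ V] (B : E2 →L[ℝ] E2 →L[ℝ] V) :
      B u v = ∑ i, ∑ j, (u i * v j) • B (EuclideanSpace.single i 1) (EuclideanSpace.single j 1) := by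
    have hw (w : E2) : w = w 0 • EuclideanSpace.single 0 1 + w 1 • EuclideanSpace.single 1 1 := by
      ext i; fin_cases i <;> simp
    conv_lhs => rw [hw u, hw v]
    simp only [map_add, map_smul, add_apply, smul_apply,
      Fin.sum_univ_two]
    module
  have hzl (l : Fin 2) : ∑ m, z m * metricMatrix F x p m l
      = ⟪fderiv ℝ (fderiv ℝ (inChart x (toE4 F))) p u v, pd l (inChart x (toE4 F)) p⟫ := by
    have := hz (EuclideanSpace.single l 1)
    rw [fderiv_eq_pd _ p z] at this
    rw [Fin.sum_univ_two]
    simp only [inner_add_left, real_inner_smul_left] at this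
    exact this
  have hdet : IsUnit (metricMatrix F x p).det := by
    have : (metricMatrix F x p).det = gram (inChart x (toE4 F)) p := by
      rw [Matrix.det_fin_two, gram, pow_two]
      congr 2
      exact coef_self_comm _ _
    rw [this]
    exact (h.gram_pos hp).ne'.isUnit
  have hsymm (i j : Fin 2) : metricMatrix F x p i j = metricMatrix F x p j i :=
    real_inner_comm (pd j (inChart x (toE4 F)) p) (pd i (inChart x (toE4 F)) p)
  -- Contracting the Christoffel symbols with `u, v` applies the inverse metric to the inner
  -- products `⟨D²G(u, v), ∂ₗG⟩`. By `hzl` these are the metric applied to `z`, so `z` is recovered.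
  have hΓ (k : Fin 2) : ∑ i, ∑ j, christoffel F x k i j p * (u i * v j) = z k := by
    have e1 : ∑ i, ∑ j, christoffel F x k i j p * (u i * v j)
        = ∑ l, (metricMatrix F x p)⁻¹ k l *
          ⟪fderiv ℝ (fderiv ℝ (inChart x (toE4 F))) p u v, pd l (inChart x (toE4 F)) p⟫ := by
      rw [hsum]
      simp only [christoffel_eq hG, Fin.sum_univ_two, inner_add_left, real_inner_smul_left]
      ring
    rw [e1]
    simp only [← hzl]
    have e2 := congrArg (fun A => A.mulVec z.ofLp k) (Matrix.nonsing_inv_mul _ hdet)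
    simp only [Matrix.one_mulVec, ← Matrix.mulVec_mulVec] at e2
    rw [← e2]
    simp only [Matrix.mulVec, dotProduct]
    refine Finset.sum_congr rfl fun l _ => ?_
    congr 1
    exact Finset.sum_congr rfl fun m _ => by rw [hsymm, mul_comm]
  rw [hsum (fderiv ℝ (fderiv ℝ φ) p), fderiv_eq_pd φ p z, ← hΓ 0, ← hΓ 1]
  simp only [hpp, Fin.sum_univ_two, smul_eq_mul]
  ring

/-- The Hessian in the direction of a vector field of a principal frame. -/
lemma IsMovingFrame.hessian_eq {U : Set E2} {N : E2 → E4} {k l : E2 → ℝ} {X Y : E2 → E2}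
    (h : IsMovingFrame U (inChart x (toE4 F)) N k l X Y) (hp : extChartAt (𝓡 2) x x ∈ U)
    {f : M → ℝ} {φ : E2 → ℝ} (hφ : ContDiffOn ℝ ∞ φ U)
    (hfφ : inChart x f =ᶠ[𝓝 (extChartAt (𝓡 2) x x)] φ) :
    hessian F f x (X (extChartAt (𝓡 2) x x)) (X (extChartAt (𝓡 2) x x))
      = dirDeriv X (dirDeriv X φ) (extChartAt (𝓡 2) x x)
        - conn (inChart x (toE4 F)) X Y (extChartAt (𝓡 2) x x)
          * dirDeriv Y φ (extChartAt (𝓡 2) x x) := by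
  have hφ2 : ContDiffAt ℝ 2 φ (extChartAt (𝓡 2) x x) :=
    (hφ.contDiffAt (h.isOpen.mem_nhds hp)).of_le (WithTop.coe_le_coe.2 le_top)
  have hG : ContDiffAt ℝ 2 (inChart x (toE4 F)) (extChartAt (𝓡 2) x x) :=
    (h.smooth_G.contDiffAt (h.isOpen.mem_nhds hp)).of_le (WithTop.coe_le_coe.2 le_top)
  have dX := differentiableAt_of_contDiffOn h.isOpen h.smooth_X hp
  -- This `z` comes from `X(XG) = D²G(X, X) + dG(DX(X))`, whose left side has tangential part `A
  -- dG(Y)`.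
  rw [WeingartenS3.hessian_eq h.toIsPatch hp (hφ2.congr_of_eventuallyEq hfφ)
    (z := conn (inChart x (toE4 F)) X Y (extChartAt (𝓡 2) x x) • Y (extChartAt (𝓡 2) x x)
      - fderiv ℝ X (extChartAt (𝓡 2) x x) (X (extChartAt (𝓡 2) x x)))]
  · rw [hfφ.fderiv_eq, hfφ.fderiv.fderiv_eq, dirDeriv_dirDeriv hφ2 dX, map_sub, map_smul]
    unfold dirDeriv
    rw [smul_eq_mul]
    ring
  · intro w
    have e := dirDeriv_dirDeriv hG dX (X := X)
    rw [h.dirDeriv_X_X hp] at e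
    rw [eq_sub_iff_add_eq.2 e.symm, map_sub, map_smul]
    simp only [inner_sub_left, real_inner_smul_left, h.inner_N_fderiv _ hp, h.inner_G_fderiv hp]
    simp [dirDeriv]

end Hessian

/-! ### From the immersed surface to a patch in a chart. -/

lemma contMDiff_coe_S3 : ContMDiff (𝓡 3) 𝓘(ℝ, E4) ∞ ((↑) : S3 → E4) :=
  have := Fact.mk (@finrank_euclideanSpace_fin ℝ _ (3 + 1))
  contMDiff_coe_sphere

lemma injective_mvfderiv_coe_S3 (v : S3) :
    Function.Injective (mvfderiv (𝓡 3) ((↑) : S3 → E4) v) :=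
  have := Fact.mk (@finrank_euclideanSpace_fin ℝ _ (3 + 1))
  injective_mvfderiv_subtypeVal_sphere v

section Immersion

variable {M : Type*} [TopologicalSpace M] [ChartedSpace E2 M] {F : M → S3}

lemma IsSmoothImmersion.contMDiff_toE4 (hF : IsSmoothImmersion F) :
    ContMDiff (𝓡 2) 𝓘(ℝ, E4) ∞ (toE4 F) :=
  contMDiff_coe_S3.comp hF.smooth

lemma IsSmoothImmersion.injective_mvfderiv (hF : IsSmoothImmersion F) (y : M) :
    Function.Injective (mvfderiv (𝓡 2) (toE4 F) y) := by
  have h2 : ∀ v, mvfderiv (𝓡 2) (toE4 F) y v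
      = mvfderiv (𝓡 3) ((↑) : S3 → E4) (F y) (mfderiv (𝓡 2) (𝓡 3) F y v) :=
    mfderiv_comp_apply y (contMDiff_coe_S3.mdifferentiable (by simp) (F y))
      (hF.smooth.mdifferentiable (by simp) y)
  intro v w hvw
  rw [h2, h2] at hvw
  exact hF.injective y (injective_mvfderiv_coe_S3 _ hvw)

end Immersion

section Transfer

variable {M : Type*} [TopologicalSpace M] [ChartedSpace E2 M] [IsManifold (𝓡 2) ∞ M]
  {V : Type*} [NormedAddCommGroup V] [NormedSpace ℝ V]

lemma contDiffOn_inChart {f : M → V} (hf : ContMDiff (𝓡 2) 𝓘(ℝ, V) ∞ f) (x : M) :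
    ContDiffOn ℝ ∞ (inChart x f) (extChartAt (𝓡 2) x).target := by
  rw [← contMDiffOn_iff_contDiffOn]
  exact hf.comp_contMDiffOn (contMDiffOn_extChartAt_symm x)

/-- The differential of a function on the surface in the chart around `x`. -/
lemma mvfderiv_eq_fderiv_inChart {f : M → V} {x y : M} (hy : y ∈ (extChartAt (𝓡 2) x).source)
    (hf : DifferentiableAt ℝ (inChart x f) (extChartAt (𝓡 2) x y)) (v : TangentSpace (𝓡 2) y) :
    mvfderiv (𝓡 2) f y v = fderiv ℝ (inChart x f) (extChartAt (𝓡 2) x y)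
      (mvfderiv (𝓡 2) (extChartAt (𝓡 2) x) y v) := by
  have : IsManifold (𝓡 2) 1 M := IsManifold.of_le (n := ∞) (by simp)
  have hφ := mdifferentiableAt_extChartAt (I := 𝓡 2) (x := x) (y := y) (by simpa using hy)
  have hE : f =ᶠ[𝓝 y] inChart x f ∘ extChartAt (𝓡 2) x := by
    filter_upwards [(isOpen_extChartAt_source (I := 𝓡 2) x).mem_nhds hy] with z hz
    exact congrArg f ((extChartAt (𝓡 2) x).left_inv hz).symm
  have e1 : mvfderiv (𝓡 2) f y v = mvfderiv (𝓡 2) (inChart x f ∘ extChartAt (𝓡 2) x) y v := by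
    unfold mvfderiv
    simp only [ContinuousLinearMap.comp_apply]
    rw [hE.mfderiv_eq]
    rfl
  have e2 : mvfderiv (𝓡 2) (inChart x f ∘ extChartAt (𝓡 2) x) y v
      = mvfderiv 𝓘(ℝ, E2) (inChart x f) (extChartAt (𝓡 2) x y)
        (mfderiv (𝓡 2) 𝓘(ℝ, E2) (extChartAt (𝓡 2) x) y v) :=
    mfderiv_comp_apply y hf.mdifferentiableAt hφ v
  have e3 : mvfderiv 𝓘(ℝ, E2) (inChart x f) (extChartAt (𝓡 2) x y)
      = fderiv ℝ (inChart x f) (extChartAt (𝓡 2) x y) := by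
    unfold mvfderiv
    rw [mfderiv_eq_fderiv]
    rfl
  rw [e1, e2, e3]
  rfl

/-- At the base point the preferred chart has identity differential, so tangent vectors at `x` may
be used directly as vectors of the plane. -/
lemma mvfderiv_self_eq {f : M → V} {x : M}
    (hf : DifferentiableAt ℝ (inChart x f) (extChartAt (𝓡 2) x x)) (v : TangentSpace (𝓡 2) x) :
    mvfderiv (𝓡 2) f x v = fderiv ℝ (inChart x f) (extChartAt (𝓡 2) x x) v := by
  have : IsManifold (𝓡 2) 1 M := IsManifold.of_le (n := ∞) (by simp)
  rw [mvfderiv_eq_fderiv_inChart (mem_extChartAt_source x) hf]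
  congr 1
  unfold mvfderiv
  rw [mfderiv_extChartAt_self]
  rfl

lemma bijective_mfderiv_extChartAt {x y : M} (hy : y ∈ (extChartAt (𝓡 2) x).source) :
    Function.Bijective (mvfderiv (𝓡 2) (extChartAt (𝓡 2) x) y) := by
  have : IsManifold (𝓡 2) 1 M := IsManifold.of_le (n := ∞) (by simp)
  obtain ⟨A, hA⟩ := isInvertible_mfderiv_extChartAt hy
  unfold mvfderiv
  rw [← hA]
  exact A.bijective

variable {F : M → S3} {ν : M → E4}

/-- An immersion with unit normal, read in a chart. -/
lemma isPatch_inChart (hF : IsSmoothImmersion F) (hν : IsUnitNormal F ν) (x : M) :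
    IsPatch (extChartAt (𝓡 2) x).target (inChart x (toE4 F)) (inChart x ν) := by
  have sG := contDiffOn_inChart hF.contMDiff_toE4 x
  have hO : IsOpen (extChartAt (𝓡 2) x).target := isOpen_extChartAt_target x
  have key : ∀ q ∈ (extChartAt (𝓡 2) x).target, ∀ v,
      mvfderiv (𝓡 2) (toE4 F) ((extChartAt (𝓡 2) x).symm q) v
        = fderiv ℝ (inChart x (toE4 F)) q
          (mvfderiv (𝓡 2) (extChartAt (𝓡 2) x) ((extChartAt (𝓡 2) x).symm q) v) := by
    intro q hq v
    have hr := (extChartAt (𝓡 2) x).right_inv hq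
    have := mvfderiv_eq_fderiv_inChart (f := toE4 F) ((extChartAt (𝓡 2) x).map_target hq)
      (by rw [hr]; exact differentiableAt_of_contDiffOn hO sG hq) v
    rw [hr] at this
    exact this
  refine ⟨hO, sG, contDiffOn_inChart hν.smooth x, ?_, ?_, ?_, ?_, ?_⟩
  -- Away from the base point the chart differential is only bijective; this is enough to write
  -- every plane vector as the image of a tangent vector.
  · intro q hq v w hvw
    have hb := bijective_mfderiv_extChartAt (M := M) ((extChartAt (𝓡 2) x).map_target hq)
    obtain ⟨v', rfl⟩ := hb.2 v
    obtain ⟨w', rfl⟩ := hb.2 w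
    rw [← key q hq v', ← key q hq w'] at hvw
    rw [hF.injective_mvfderiv _ hvw]
  · intro q _
    simp [inChart, toE4]
  · intro q _
    simp [inChart, hν.norm_eq_one]
  · intro q _
    exact hν.tangent_sphere _
  · intro q hq w
    have hb := bijective_mfderiv_extChartAt (M := M) ((extChartAt (𝓡 2) x).map_target hq)
    obtain ⟨w', rfl⟩ := hb.2 w
    rw [← key q hq w']
    exact hν.normal_surface _ _

lemma mem_principalCurvatures_iff (hF : IsSmoothImmersion F) (hν : IsUnitNormal F ν) {x y : M}
    (hy : y ∈ (extChartAt (𝓡 2) x).source) (κ : ℝ) :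
    κ ∈ principalCurvatures F ν y ↔
      ∃ v ≠ 0, IsEigen (inChart x (toE4 F)) (inChart x ν) (extChartAt (𝓡 2) x y) κ v := by
  have hq := (extChartAt (𝓡 2) x).map_source hy
  have hP := isPatch_inChart hF hν x
  have hb := bijective_mfderiv_extChartAt (M := M) hy
  have kG := mvfderiv_eq_fderiv_inChart (f := toE4 F) hy
    (differentiableAt_of_contDiffOn hP.isOpen hP.smooth_G hq)
  have kN := mvfderiv_eq_fderiv_inChart (f := ν) hy
    (differentiableAt_of_contDiffOn hP.isOpen hP.smooth_N hq)
  unfold principalCurvatures IsEigen secondForm firstForm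
  simp only [Set.mem_ofPred_eq, kG, kN]
  constructor
  · rintro ⟨v, hv, h⟩
    refine ⟨_, (map_ne_zero_iff _ hb.1).2 hv, fun w => ?_⟩
    obtain ⟨w', rfl⟩ := hb.2 w
    exact h w'
  · rintro ⟨v, hv, h⟩
    obtain ⟨v', rfl⟩ := hb.2 v
    exact ⟨v', (map_ne_zero_iff _ hb.1).1 hv, fun w => h _⟩

/-- Away from umbilics the principal curvatures are the roots of the characteristic polynomial. -/
lemma lam_eq_curv (hF : IsSmoothImmersion F) (hν : IsUnitNormal F ν) {x y : M}
    (hy : y ∈ (extChartAt (𝓡 2) x).source)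
    (hd : 0 < shapeDisc (inChart x (toE4 F)) (inChart x ν) (extChartAt (𝓡 2) x y)) :
    lam F ν 0 y = curv (inChart x (toE4 F)) (inChart x ν) 1 (extChartAt (𝓡 2) x y) ∧
    lam F ν 1 y = curv (inChart x (toE4 F)) (inChart x ν) (-1) (extChartAt (𝓡 2) x y) := by
  have hS : principalCurvatures F ν y
      = {curv (inChart x (toE4 F)) (inChart x ν) 1 (extChartAt (𝓡 2) x y),
        curv (inChart x (toE4 F)) (inChart x ν) (-1) (extChartAt (𝓡 2) x y)} := by
    ext κ
    rw [mem_principalCurvatures_iff hF hν hy,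
      (isPatch_inChart hF hν x).exists_isEigen_iff ((extChartAt (𝓡 2) x).map_source hy),
      root_iff hd]
    rfl
  have hlt := curv_sub_pos hd
  constructor
  · change sSup (principalCurvatures F ν y) = _
    rw [hS, csSup_pair, sup_eq_left.2 hlt.le]
  · change sInf (principalCurvatures F ν y) = _
    rw [hS, csInf_pair, inf_eq_right.2 hlt.le]

end Transfer

/-! ### The Weingarten relation and the given principal frame. -/

/-- Differentiating the relation `k + l = ψ (k - l)`. -/
lemma fderiv_weingarten {k l : E2 → ℝ} {ψ : ℝ → ℝ} {q : E2} (hk : DifferentiableAt ℝ k q)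
    (hl : DifferentiableAt ℝ l q) (hψ : DifferentiableAt ℝ ψ (k q - l q))
    (h : ∀ᶠ z in 𝓝 q, k z + l z = ψ (k z - l z)) (w : E2) :
    fderiv ℝ k q w + fderiv ℝ l q w
      = deriv ψ (k q - l q) * (fderiv ℝ k q w - fderiv ℝ l q w) := by
  have h1 := (hk.hasFDerivAt.add hl.hasFDerivAt).congr_of_eventuallyEq
    (f₁ := fun z => ψ (k z - l z)) (h.mono fun z hz => hz.symm)
  have h2 := hψ.hasDerivAt.comp_hasFDerivAt q (hk.hasFDerivAt.sub hl.hasFDerivAt)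
  simpa using congrArg (fun A => A w) (h1.unique h2)

lemma differentiableAt_deriv {ψ : ℝ → ℝ} {t : ℝ} (hψ : ContDiffAt ℝ 2 ψ t) :
    DifferentiableAt ℝ (deriv ψ) t :=
  ((hψ.fderiv_right (m := 1) (by norm_num)).differentiableAt (by simp)).clm_apply
    (differentiableAt_const 1)

section Surface

variable {M : Type*} [TopologicalSpace M] [ChartedSpace E2 M] [IsManifold (𝓡 2) ∞ M]
  {F : M → S3} {ν : M → E4} {x : M} {e : Fin 2 → TangentSpace (𝓡 2) x}

lemma IsPrincipalFrame.inner_self (he : IsPrincipalFrame F ν x e) (hF : IsSmoothImmersion F)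
    (hν : IsUnitNormal F ν) (i : Fin 2) :
    ⟪fderiv ℝ (inChart x (toE4 F)) (extChartAt (𝓡 2) x x) (e i),
      fderiv ℝ (inChart x (toE4 F)) (extChartAt (𝓡 2) x x) (e i)⟫ = 1 := by
  have hP := isPatch_inChart hF hν x
  have h := he.orthonormal i i
  unfold firstForm at h
  rwa [mvfderiv_self_eq (differentiableAt_of_contDiffOn hP.isOpen hP.smooth_G
    (mem_extChartAt_target x)), if_pos rfl] at h

lemma IsPrincipalFrame.isEigen (he : IsPrincipalFrame F ν x e) (hF : IsSmoothImmersion F)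
    (hν : IsUnitNormal F ν) (i : Fin 2) :
    IsEigen (inChart x (toE4 F)) (inChart x ν) (extChartAt (𝓡 2) x x) (lam F ν i x) (e i) := by
  have hP := isPatch_inChart hF hν x
  have kG := mvfderiv_self_eq (f := toE4 F) (differentiableAt_of_contDiffOn hP.isOpen hP.smooth_G
    (mem_extChartAt_target x))
  have kN := mvfderiv_self_eq (f := ν) (differentiableAt_of_contDiffOn hP.isOpen hP.smooth_N
    (mem_extChartAt_target x))
  have h := he.principal i
  unfold firstForm secondForm at h
  simp only [kG, kN] at h
  exact h

/-- The functions `lam` are defined as a supremum and an infimum; the frame vectors realise both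
values as eigenvalues, hence as two distinct roots. -/
lemma IsPrincipalFrame.shapeDisc_pos (he : IsPrincipalFrame F ν x e) (hF : IsSmoothImmersion F)
    (hν : IsUnitNormal F ν) (hx : lam F ν 1 x < lam F ν 0 x) :
    0 < shapeDisc (inChart x (toE4 F)) (inChart x ν) (extChartAt (𝓡 2) x x) := by
  have hr (i : Fin 2) := ((isPatch_inChart hF hν x).exists_isEigen_iff
    (mem_extChartAt_target x) (lam F ν i x)).1 ⟨e i, fun h0 => by
      have := he.inner_self hF hν i
      rw [h0] at this
      simp at this, he.isEigen hF hν i⟩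
  exact WeingartenS3.shapeDisc_pos hx.ne' (hr 0) (hr 1)

end Surface

end WeingartenS3

end

/-! ### Proof of the two identities. -/

open Filter Topology WeingartenS3 in
theorem mainTheorem5 {M : Type*} [TopologicalSpace M] [ChartedSpace (EuclideanSpace ℝ (Fin 2)) M]
    [IsManifold (𝓡 2) ∞ M]
    (F : M → WeingartenS3.S3) (hF : WeingartenS3.IsSmoothImmersion F)
    (ν : M → WeingartenS3.E4) (hν : WeingartenS3.IsUnitNormal F ν)
    (lam : Fin 2 → M → ℝ) (hlam : lam = WeingartenS3.lam F ν)
    (ψ : ℝ → ℝ) (hW : ∀ y : M, lam 0 y + lam 1 y = ψ (lam 0 y - lam 1 y))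
    (x : M) (hx : lam 1 x < lam 0 x)
    (hψ : ContDiffAt ℝ 2 ψ (lam 0 x - lam 1 x))
    (β : Fin 2 → ℝ) (hβ : β = WeingartenS3.weight F ν ψ x) (hβ0 : ∀ i, β i ≠ 0)
    (e : Fin 2 → TangentSpace (𝓡 2) x) (he : WeingartenS3.IsPrincipalFrame F ν x e)
    (D : Fin 2 → Fin 2 → ℝ) (hD : ∀ i k, D i k = mvfderiv (𝓡 2) (lam k) x (e i)) :
    (∀ k, ContMDiffAt (𝓡 2) 𝓘(ℝ, ℝ) ∞ (lam k) x) ∧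
    ((∑ i, β i * WeingartenS3.hessian F (lam 0) x (e i) (e i))
          + (∑ i, β i * (lam i x ^ 2 - 1)) * lam 0 x
          - (∑ i, β i * lam i x) * (lam 0 x ^ 2 - 1)
        = 2 * (β 1 / (lam 0 x - lam 1 x)) * (D 0 1 ^ 2 + D 1 0 ^ 2)
          + deriv (deriv ψ) (lam 0 x - lam 1 x) * ((β 0 + β 1) ^ 2 / β 0 ^ 2) * D 0 1 ^ 2) ∧
    ((∑ i, β i * WeingartenS3.hessian F (lam 1) x (e i) (e i))
          + (∑ i, β i * (lam i x ^ 2 - 1)) * lam 1 x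
          - (∑ i, β i * lam i x) * (lam 1 x ^ 2 - 1)
        = -2 * (β 0 / (lam 0 x - lam 1 x)) * (D 0 1 ^ 2 + D 1 0 ^ 2)
          + deriv (deriv ψ) (lam 0 x - lam 1 x) * ((β 0 + β 1) ^ 2 / β 1 ^ 2) * D 1 0 ^ 2) := by
  subst hlam
  set G := inChart x (toE4 F) with hG
  set N := inChart x ν with hN
  set p := extChartAt (𝓡 2) x x with hp
  have hP₀ := isPatch_inChart hF hν x
  have hpT : p ∈ (extChartAt (𝓡 2) x).target := mem_extChartAt_target x
  have hdp : 0 < shapeDisc G N p := he.shapeDisc_pos hF hν hx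
  -- The non-umbilic part of the chart domain, where both roots are smooth.
  set U := (extChartAt (𝓡 2) x).target ∩ shapeDisc G N ⁻¹' Set.Ioi 0 with hU
  have hUo : IsOpen U :=
    hP₀.smooth_shapeDisc.continuousOn.isOpen_inter_preimage hP₀.isOpen isOpen_Ioi
  have hpU : p ∈ U := ⟨hpT, hdp⟩
  have hP : IsPatch U G N := hP₀.mono hUo Set.inter_subset_left
  have hd : ∀ q ∈ U, 0 < shapeDisc G N q := fun q hq => hq.2
  set K : Fin 2 → E2 → ℝ := ![curv G N 1, curv G N (-1)] with hK
  have hKs (k : Fin 2) : ContDiffOn ℝ ∞ (K k) U := by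
    fin_cases k
    · exact hP.smooth_curv hd 1
    · exact hP.smooth_curv hd (-1)
  have hlK (k : Fin 2) {y : M} (hy : y ∈ (extChartAt (𝓡 2) x).source)
      (hyU : extChartAt (𝓡 2) x y ∈ U) :
      WeingartenS3.lam F ν k y = K k (extChartAt (𝓡 2) x y) := by
    have := lam_eq_curv hF hν hy hyU.2
    fin_cases k
    · exact this.1
    · exact this.2
  have hlKx (k : Fin 2) : WeingartenS3.lam F ν k x = K k p :=
    hlK k (mem_extChartAt_source x) hpU
  have hcK (k : Fin 2) {q : E2} (hq : q ∈ U) : inChart x (WeingartenS3.lam F ν k) q = K k q := by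
    have hr := (extChartAt (𝓡 2) x).right_inv hq.1
    have := hlK k ((extChartAt (𝓡 2) x).map_target hq.1) (by rwa [hr])
    rwa [hr] at this
  have hcE (k : Fin 2) : inChart x (WeingartenS3.lam F ν k) =ᶠ[𝓝 p] K k :=
    eventually_of_mem (hUo.mem_nhds hpU) fun q hq => hcK k hq
  have hsm (k : Fin 2) : ContMDiffAt (𝓡 2) 𝓘(ℝ, ℝ) ∞ (WeingartenS3.lam F ν k) x := by
    have h1 : ContMDiffAt (𝓡 2) 𝓘(ℝ, ℝ) ∞ (K k ∘ extChartAt (𝓡 2) x) x :=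
      ((hKs k).contDiffAt (hUo.mem_nhds hpU)).contMDiffAt.comp x contMDiffAt_extChartAt
    refine h1.congr_of_eventuallyEq ?_
    filter_upwards [extChartAt_source_mem_nhds (I := 𝓡 2) x,
      (continuousAt_extChartAt (I := 𝓡 2) x).preimage_mem_nhds (hUo.mem_nhds hpU)] with y hy hyU
    exact hlK k hy hyU
  have heig (i : Fin 2) : IsEigen G N p (K i p) (e i) := by
    rw [← hlKx]
    exact he.isEigen hF hν i
  obtain ⟨V, X, Y, hpV, hVU, hX, hY, hfr⟩ := hP.exists_isMovingFrame hpU hd (heig 0) (heig 1)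
    (he.inner_self hF hν 0) (he.inner_self hF hν 1)
  have hKV (k : Fin 2) : ContDiffOn ℝ ∞ (K k) V := (hKs k).mono hVU
  have hKd (k : Fin 2) {q : E2} (hq : q ∈ V) : DifferentiableAt ℝ (K k) q :=
    differentiableAt_of_contDiffOn hfr.isOpen (hKV k) hq
  have hWK : ∀ q ∈ V, K 0 q + K 1 q = ψ (K 0 q - K 1 q) := by
    intro q hq
    rw [← hcK 0 (hVU hq), ← hcK 1 (hVU hq)]
    exact hW _
  rw [hlKx, hlKx] at hψ
  -- Since `ψ` is regular only near `λ₁(x) - λ₂(x)`, the relation is differentiated only at points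
  -- where the difference stays close to that value.
  have hψd : ∀ᶠ q in 𝓝 p, DifferentiableAt ℝ ψ (K 0 q - K 1 q) :=
    ((hKd 0 hpV).continuousAt.sub (hKd 1 hpV).continuousAt).eventually
      ((hψ.eventually (by simp)).mono fun t ht => ht.differentiableAt (by simp))
  set s : E2 → ℝ := fun q => deriv ψ (K 0 q - K 1 q) with hs
  have hWd : ∀ᶠ q in 𝓝 p, ∀ w, fderiv ℝ (K 0) q w + fderiv ℝ (K 1) q w
      = s q * (fderiv ℝ (K 0) q w - fderiv ℝ (K 1) q w) := by
    filter_upwards [hψd, hfr.isOpen.mem_nhds hpV] with q hq hqV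
    exact fderiv_weingarten (hKd 0 hqV) (hKd 1 hqV) hq
      (eventually_of_mem (hfr.isOpen.mem_nhds hqV) hWK)
  have hsF := (differentiableAt_deriv hψ).hasDerivAt.comp_hasFDerivAt p
    ((hKd 0 hpV).hasFDerivAt.sub (hKd 1 hpV).hasFDerivAt)
  have hsd : DifferentiableAt ℝ s p := hsF.differentiableAt
  have hds (w : E2) : fderiv ℝ s p w
      = deriv (deriv ψ) (K 0 p - K 1 p) * (fderiv ℝ (K 0) p w - fderiv ℝ (K 1) p w) := by
    have h := congrArg (fun A => A w) hsF.fderiv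
    simp only [smul_apply, sub_apply, smul_eq_mul] at h
    exact h
  have hβ₀ : β 0 = 1 - s p := by rw [hβ, hs]; simp only [← hlKx]; rfl
  have hβ₁ : β 1 = 1 + s p := by rw [hβ, hs]; simp only [← hlKx]; rfl
  have hne : K 0 p ≠ K 1 p := by rw [← hlKx, ← hlKx]; exact hx.ne'
  have hDX (k : Fin 2) : D 0 k = dirDeriv X (K k) p := by
    rw [hD, mvfderiv_self_eq ((hKd k hpV).congr_of_eventuallyEq (hcE k)), ← hp,
      (hcE k).fderiv_eq, ← hX]
    rfl
  have hDY (k : Fin 2) : D 1 k = dirDeriv Y (K k) p := by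
    rw [hD, mvfderiv_self_eq ((hKd k hpV).congr_of_eventuallyEq (hcE k)), ← hp,
      (hcE k).fderiv_eq, ← hY]
    rfl
  have hHX (k : Fin 2) : hessian F (WeingartenS3.lam F ν k) x (e 0) (e 0)
      = dirDeriv X (dirDeriv X (K k)) p - conn G X Y p * dirDeriv Y (K k) p := by
    rw [← hX]
    exact hfr.hessian_eq hpV (hKV k) (hcE k)
  have hHY (k : Fin 2) : hessian F (WeingartenS3.lam F ν k) x (e 1) (e 1)
      = dirDeriv Y (dirDeriv Y (K k)) p - conn G Y X p * dirDeriv X (K k) p := by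
    rw [← hY]
    exact hfr.swap.hessian_eq hpV (hKV k) (hcE k)
  have main₁ := hfr.simons hpV hsd hds hWd hne (hβ₀ ▸ hβ0 0)
  -- Interchanging `k` and `l` reverses the sign of their difference, so `s` becomes `-s`; then
  -- `d(-s) = c (dl - dk)` with the same constant `c`.
  have main₂ := hfr.swap.simons hpV (s := fun q => -s q)
    (c := deriv (deriv ψ) (K 0 p - K 1 p)) hsd.neg
    (fun w => by
      rw [fderiv_fun_neg, neg_apply, hds]
      simp only [hK, Matrix.cons_val]
      ring)
    (hWd.mono fun q hq w => by
      have := hq w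
      simp only [hK, Matrix.cons_val] at this
      linarith)
    hne.symm (by rw [sub_neg_eq_add, ← hβ₁]; exact hβ0 1)
  simp only [sub_neg_eq_add, ← sub_eq_add_neg] at main₂
  have k0 : curv G N 1 = K 0 := rfl
  have k1 : curv G N (-1) = K 1 := rfl
  rw [k0, k1, ← hβ₀, ← hβ₁] at main₁ main₂
  refine ⟨hsm, ?_, ?_⟩
  · simp only [Fin.sum_univ_two, hHX, hHY, hlKx, hDX, hDY]
    exact main₁
  · simp only [Fin.sum_univ_two, hHX, hHY, hlKx, hDX, hDY]
    have hsw : 2 * (β 0 / (K 1 p - K 0 p)) = -2 * (β 0 / (K 0 p - K 1 p)) := by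
      rw [← neg_sub (K 0 p), div_neg]; ring
    rw [hsw] at main₂
    linear_combination main₂
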